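/- Let $k$ be an algebraically closed field, let $A$ be a finite dimensional (associative, unital) $k$-algebra and let $B\subseteq A$ be a (unital) subalgebra. Write $B^e=B\otimes_k B^{op}$ and $A^e=A\otimes_k A^{op}$ for the enveloping algebras, so that bimodules are left modules over them. Suppose that the extension $B\subseteq A$ is strongly proj-bounded, that is: 1. $A/B$ has finite projective dimension as a $B^e$-module; 2. $A/B$ is projective as a left or as a right $B$-module; 3. there is a natural number $p\ge 1$ such that the tensor power $(A/B)^{\otimes_B n}$ is projective as a $B^e$-module for every $n\ge p$; 4. $A$ has finite $(A^e,B^e)$-relative projective dimension: for some $n$ there is an exact sequence of $A^e$-modules $0\to P_n\to\cdots\to P_0\to A\to 0$ in which the kernel of every map is a direct summand as a $B^e$-module and every $P_i$ is $(A^e,B^e)$-projective (every $A^e$-linear surjection onto $P_i$ that splits over $B^e$ splits over $A^e$). Suppose moreover that, in 2, $A/B$ is projective as a right $B$-module. For a ring $R$ let the (left, little) finitistic dimension $\mathrm{findim}(R)$ be the supremum of the projective dimensions of the finitely generated left $R$-modules of finite projective dimension. Then $\mathrm{findim}(B)$ is finite if and only if $\mathrm{findim}(A)$ is finite. -/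

import Mathlib

open scoped TensorProduct

universe u v

noncomputable section

namespace ProjBounded

/-! ### Bimodules over a `k`-algebra -/

/-- A `B`-bimodule, `B` a `k`-algebra: commuting left and right actions of `B`, for which the two
induced actions of `k` agree. -/
structure AlgBimodule (k : Type u) [Field k] (B : Type v) [Ring B] [Algebra k B] where
  carrier : Type v
  [addCommGroup : AddCommGroup carrier]
  [moduleBase : Module k carrier]
  [moduleLeft : Module B carrier]
  [moduleRight : Module Bᵐᵒᵖ carrier]
  [towerLeft : IsScalarTower k B carrier]
  [towerRight : IsScalarTower k Bᵐᵒᵖ carrier]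
  [comm : SMulCommClass B Bᵐᵒᵖ carrier]

namespace AlgBimodule

variable {k : Type u} [Field k] {B : Type v} [Ring B] [Algebra k B]

instance : CoeSort (AlgBimodule k B) (Type v) := ⟨AlgBimodule.carrier⟩

instance (M : AlgBimodule k B) : AddCommGroup M := M.addCommGroup
instance (M : AlgBimodule k B) : Module k M := M.moduleBase
instance (M : AlgBimodule k B) : Module B M := M.moduleLeft
instance (M : AlgBimodule k B) : Module Bᵐᵒᵖ M := M.moduleRight
instance (M : AlgBimodule k B) : IsScalarTower k B M := M.towerLeft
instance (M : AlgBimodule k B) : IsScalarTower k Bᵐᵒᵖ M := M.towerRight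
instance (M : AlgBimodule k B) : SMulCommClass B Bᵐᵒᵖ M := M.comm

/-- A `B`-bimodule as a left module over the enveloping algebra `Bᵉ = B ⊗ₖ Bᵒᵖ`:
`(b ⊗ b') • m = b m b'`. -/
instance (M : AlgBimodule k B) : Module (B ⊗[k] Bᵐᵒᵖ) M := TensorProduct.Algebra.module

/-- A `k`-space with commuting left and right representations of `B`, as a bimodule. -/
def ofReps (V : Type v) [AddCommGroup V] [Module k V] (l : B →ₐ[k] Module.End k V)
    (r : Bᵐᵒᵖ →ₐ[k] Module.End k V) (h : ∀ b c x, l b (r c x) = r c (l b x)) :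
    AlgBimodule k B :=
  letI : Module B V := Module.compHom V (l : B →+* Module.End k V)
  letI : Module Bᵐᵒᵖ V := Module.compHom V (r : Bᵐᵒᵖ →+* Module.End k V)
  { carrier := V
    towerLeft := ⟨fun a b x => by
      change l (a • b) x = a • l b x
      rw [map_smul, LinearMap.smul_apply]⟩
    towerRight := ⟨fun a b x => by
      change r (a • b) x = a • r b x
      rw [map_smul, LinearMap.smul_apply]⟩
    comm := ⟨h⟩ }

/-- The representation induced on the quotient by an invariant subspace. -/
def quotRep {C : Type v} [Ring C] [Algebra k C] {V : Type v} [AddCommGroup V] [Module k V]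
    (l : C →ₐ[k] Module.End k V) (W : Submodule k V) (h : ∀ c, W ≤ W.comap (l c)) :
    C →ₐ[k] Module.End k (V ⧸ W) where
  toFun c := W.mapQ W (l c) (h c)
  map_one' := by ext x; simp
  map_mul' a b := by ext x; simp
  map_zero' := by ext x; simp
  map_add' a b := by ext x; simp
  commutes' a := by ext x; simp

/-- `B` as a bimodule over itself. -/
def regular (k : Type u) [Field k] (B : Type v) [Ring B] [Algebra k B] : AlgBimodule k B where
  carrier := B

/-- The relations `m b ⊗ n = m ⊗ b n`. -/
def balancing (M N : AlgBimodule k B) : Submodule k (M ⊗[k] N) :=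
  Submodule.span k
    {t | ∃ (m : M) (b : B) (n : N), t = (MulOpposite.op b • m) ⊗ₜ[k] n - m ⊗ₜ[k] (b • n)}

/-- The left action of `B` on `M ⊗ₖ N` through `M`. -/
def tensorLeft (M N : AlgBimodule k B) : B →ₐ[k] Module.End k (M ⊗[k] N) :=
  (Module.End.rTensorAlgHom k M N).comp (Algebra.lsmul k k M)

/-- The right action of `B` on `M ⊗ₖ N` through `N`. -/
def tensorRight (M N : AlgBimodule k B) : Bᵐᵒᵖ →ₐ[k] Module.End k (M ⊗[k] N) :=
  (Module.End.lTensorAlgHom k N M).comp (Algebra.lsmul k k N)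

theorem tensorLeft_tmul (M N : AlgBimodule k B) (c : B) (m : M) (n : N) :
    tensorLeft M N c (m ⊗ₜ[k] n) = (c • m) ⊗ₜ[k] n := rfl

theorem tensorRight_tmul (M N : AlgBimodule k B) (c : Bᵐᵒᵖ) (m : M) (n : N) :
    tensorRight M N c (m ⊗ₜ[k] n) = m ⊗ₜ[k] (c • n) := rfl

theorem balancing_le_left (M N : AlgBimodule k B) (c : B) :
    balancing M N ≤ (balancing M N).comap (tensorLeft M N c) := by
  refine Submodule.span_le.2 ?_
  rintro _ ⟨m, b, n, rfl⟩
  refine Submodule.subset_span ⟨c • m, b, n, ?_⟩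
  rw [map_sub, tensorLeft_tmul, tensorLeft_tmul, smul_comm c (MulOpposite.op b) m]

theorem balancing_le_right (M N : AlgBimodule k B) (c : Bᵐᵒᵖ) :
    balancing M N ≤ (balancing M N).comap (tensorRight M N c) := by
  refine Submodule.span_le.2 ?_
  rintro _ ⟨m, b, n, rfl⟩
  refine Submodule.subset_span ⟨m, b, c • n, ?_⟩
  rw [map_sub, tensorRight_tmul, tensorRight_tmul, smul_comm b c n]

theorem tensor_comm (M N : AlgBimodule k B) (b : B) (c : Bᵐᵒᵖ) (t : M ⊗[k] N) :
    tensorLeft M N b (tensorRight M N c t) = tensorRight M N c (tensorLeft M N b t) := by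
  induction t with
  | zero => simp
  | tmul m n => simp only [tensorLeft_tmul, tensorRight_tmul]
  | add x y hx hy => rw [map_add, map_add, hx, hy, map_add, map_add]

/-- The tensor product `M ⊗_B N` of bimodules, with `b (m ⊗ n) b' = b m ⊗ n b'`. -/
def tensor (M N : AlgBimodule k B) : AlgBimodule k B :=
  ofReps ((M ⊗[k] N) ⧸ balancing M N)
    (quotRep (tensorLeft M N) (balancing M N) (balancing_le_left M N))
    (quotRep (tensorRight M N) (balancing M N) (balancing_le_right M N))
    (fun b c x => by
      induction x using Submodule.Quotient.induction_on with
      | H t => exact congrArg (Submodule.Quotient.mk (p := balancing M N)) (tensor_comm M N b c t))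

/-- The tensor powers `M^{⊗_B n}`: `M^{⊗ 0} = B` and `M^{⊗ (n + 1)} = M ⊗_B M^{⊗ n}`. -/
def tensorPower (M : AlgBimodule k B) : ℕ → AlgBimodule k B
  | 0 => regular k B
  | n + 1 => tensor M (tensorPower M n)

end AlgBimodule

/-! ### The bimodule `A / B` of an extension -/

variable {k : Type u} [Field k] {A : Type v} [Ring A] [Algebra k A]

/-- Left multiplication of `B` on `A`. -/
def mulLeftRep (B : Subalgebra k A) : B →ₐ[k] Module.End k A :=
  (Algebra.lsmul k k A).comp B.val

/-- Right multiplication of `B` on `A`. -/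
def mulRightRep (B : Subalgebra k A) : (↥B)ᵐᵒᵖ →ₐ[k] Module.End k A :=
  (Algebra.lsmul k k A).comp (AlgHom.op B.val)

/-- The `B`-bimodule `A / B`. -/
def quotientBimodule (B : Subalgebra k A) : AlgBimodule k B :=
  AlgBimodule.ofReps (A ⧸ Subalgebra.toSubmodule B)
    (AlgBimodule.quotRep (mulLeftRep B) (Subalgebra.toSubmodule B)
      (fun c _ hx => B.mul_mem c.2 hx))
    (AlgBimodule.quotRep (mulRightRep B) (Subalgebra.toSubmodule B)
      (fun c _ hx => B.mul_mem hx c.unop.2))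
    (fun b c x => by
      induction x using Submodule.Quotient.induction_on with
      | H a =>
        exact congrArg (Submodule.Quotient.mk (p := Subalgebra.toSubmodule B))
          (mul_assoc (b : A) a (c.unop : A)).symm)

/-- The inclusion `Bᵉ → Aᵉ` of enveloping algebras. -/
def envInclusion (B : Subalgebra k A) :
    (↥B ⊗[k] (↥B)ᵐᵒᵖ) →+* (A ⊗[k] Aᵐᵒᵖ) :=
  (Algebra.TensorProduct.map B.val (AlgHom.op B.val)).toRingHom

/-! ### Relative homological algebra of a ring extension `S → R` -/

section Relative

variable {R S : Type v} [Ring R] [Ring S] (f : S →+* R)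

/-- An additive map between `R`-modules is `S`-linear, where `S` acts through `f : S → R`. -/
def IsLinearOver {M N : Type v} [AddCommGroup M] [Module R M] [AddCommGroup N] [Module R N]
    (φ : M →+ N) : Prop :=
  ∀ (s : S) (x : M), φ (f s • x) = f s • φ x

/-- `P` is `(R, S)`-projective: every surjective `R`-linear map onto `P` that splits over `S`
splits over `R`. -/
def IsRelProjective (P : Type v) [AddCommGroup P] [Module R P] : Prop :=
  ∀ (N : Type v) [AddCommGroup N] [Module R N] (g : N →ₗ[R] P), Function.Surjective g →
    (∃ σ : P →+ N, IsLinearOver f σ ∧ ∀ x, g (σ x) = x) →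
    ∃ τ : P →ₗ[R] N, ∀ x, g (τ x) = x

/-- The `R`-submodule `K` of `M` is a direct summand of `M` over `S`: there is an `S`-linear
projection of `M` onto `K`. -/
def IsRelSummand {M : Type v} [AddCommGroup M] [Module R M] (K : Submodule R M) : Prop :=
  ∃ π : M →+ M, IsLinearOver f π ∧ (∀ x, π x ∈ K) ∧ ∀ x ∈ K, π x = x

/-- There is an `(R, S)`-exact sequence `0 → P_n → ⋯ → P_1 → P_0 → M → 0` of `R`-modules, with all
`P_i` being `(R, S)`-projective; exactness of the sequence includes that all kernels are direct
summands over `S`. (The sequence is continued by `P_i = 0` for `i > n`.) -/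
def HasRelProjResolution (M : Type v) [AddCommGroup M] [Module R M] (n : ℕ) : Prop :=
  ∃ (P : ℕ → ModuleCat.{v} R) (d : ∀ i, P (i + 1) →ₗ[R] P i) (ε : P 0 →ₗ[R] M),
    (∀ i, IsRelProjective f (P i)) ∧ (∀ i, n < i → Subsingleton (P i)) ∧
    Function.Surjective ε ∧ Function.Exact (d 0) ε ∧ (∀ i, Function.Exact (d (i + 1)) (d i)) ∧
    IsRelSummand f (LinearMap.ker ε) ∧ ∀ i, IsRelSummand f (LinearMap.ker (d i))

/-- The relative projective dimension `pd_{(R, S)} M`. -/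
def relProjectiveDimension (M : Type v) [AddCommGroup M] [Module R M] : ℕ∞ :=
  ⨅ (n : ℕ) (_ : HasRelProjResolution f M n), (n : ℕ∞)

end Relative

/-! ### Strongly proj-bounded extensions and the finitistic dimension -/

/-- The extension `B ⊆ A` is proj-bounded. -/
structure IsProjBounded (B : Subalgebra k A) : Prop where
  finite_projectiveDimension :
    CategoryTheory.projectiveDimension
      (ModuleCat.of (↥B ⊗[k] (↥B)ᵐᵒᵖ) (quotientBimodule B)) < ⊤
  projective_left_or_right :
    Module.Projective B (quotientBimodule B) ∨ Module.Projective (↥B)ᵐᵒᵖ (quotientBimodule B)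
  projective_tensorPower :
    ∃ p : ℕ, 1 ≤ p ∧ ∀ n, p ≤ n →
      Module.Projective (↥B ⊗[k] (↥B)ᵐᵒᵖ) ((quotientBimodule B).tensorPower n)

/-- The extension `B ⊆ A` is strongly proj-bounded: moreover `pd_{(Aᵉ, Bᵉ)} A` is finite. -/
structure IsStronglyProjBounded (B : Subalgebra k A) : Prop extends IsProjBounded B where
  finite_relProjectiveDimension :
    relProjectiveDimension (envInclusion B) (AlgBimodule.regular k A) < ⊤

/-- The little finitistic dimension `findim R`: the supremum of the projective dimensions of the
finitely generated left `R`-modules of finite projective dimension. -/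
def findim (R : Type v) [Ring R] : WithBot ℕ∞ :=
  ⨆ (M : ModuleCat.{v} R) (_ : Module.Finite R M)
    (_ : CategoryTheory.projectiveDimension M < ⊤), CategoryTheory.projectiveDimension M

end ProjBounded

end

/-! Let `d` bound the projective dimension of `A/B` over `Bᵉ`. Because `A/B` is right projective,
tensoring with an arbitrary `X` keeps a `Bᵉ`-resolution of it exact, and it sends projective
bimodules to projective modules. Hence `(A/B) ⊗_B X` has dimension at most `d` for every `X`
(`PdLE.bTensor`). The sequence `0 → X → A ⊗_B X → (A/B) ⊗_B X → 0` then compares `X` with its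
induced module over `B` up to `d`.

Induction preserves bounds on projective dimension (`Ind.pdLE`) and restriction raises them by at
most `d` (`pdLE_restrict`). So a bound `a` for `A` gives, through `A ⊗_B X`, the bound `a + d` for
`B`.

Conversely, a finitely generated `A`-module `M` of finite dimension also has finite dimension over
`B`, hence one bounded by some `c ≥ d`. What remains is to bound the dimension over `A` by `c + n`,
where `n` is the length of a relative resolution of `A` (`pdLE_of_restrict`). The relative
resolution is compared with the repeated kernels of the counits `A ⊗_B X → X`, starting from `X =
M`. These kernels keep dimension at most `c` over `B`, and the modules `A ⊗_B X` have dimension at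
most `c` over `A`. After `n` steps the comparison map is zero. Shifting back through connecting
maps, the isomorphism `A ⊗_A M → M` kills `Ext` above degree `c + n` (`extVanishesAbove_uncurry`).
-/

noncomputable section

namespace ProjBounded

/-! ### Tensor products over a noncommutative ring -/

section BTensor

variable (S : Type v) [Ring S]

/-- The relations `u s ⊗ x = u ⊗ s x` in `U ⊗ X`. -/
def BTensor.relations (U X : Type v) [AddCommGroup U] [Module Sᵐᵒᵖ U] [AddCommGroup X]
    [Module S X] : Submodule ℤ (U ⊗[ℤ] X) :=
  Submodule.span ℤ
    {t | ∃ (u : U) (s : S) (x : X), t = (MulOpposite.op s • u) ⊗ₜ[ℤ] x - u ⊗ₜ[ℤ] (s • x)}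

/-- The tensor product `U ⊗_S X` of a right `S`-module and a left `S`-module. -/
def BTensor (U X : Type v) [AddCommGroup U] [Module Sᵐᵒᵖ U] [AddCommGroup X] [Module S X] :
    Type v :=
  (U ⊗[ℤ] X) ⧸ BTensor.relations S U X

namespace BTensor

variable (U X : Type v) [AddCommGroup U] [Module Sᵐᵒᵖ U] [AddCommGroup X] [Module S X]

instance : AddCommGroup (BTensor S U X) :=
  inferInstanceAs (AddCommGroup ((U ⊗[ℤ] X) ⧸ relations S U X))

variable {U X}

/-- The class of a pure tensor. -/
def tmul (u : U) (x : X) : BTensor S U X :=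
  Submodule.Quotient.mk (p := relations S U X) (u ⊗ₜ[ℤ] x)

variable {S}

theorem induction_on {p : BTensor S U X → Prop} (t : BTensor S U X) (h0 : p 0)
    (hmul : ∀ u x, p (tmul S u x)) (hadd : ∀ a b, p a → p b → p (a + b)) : p t := by
  induction t using Submodule.Quotient.induction_on with
  | H t =>
    induction t with
    | zero => exact h0
    | tmul u x => exact hmul u x
    | add a b ha hb => exact hadd _ _ ha hb

theorem add_tmul (u u' : U) (x : X) : tmul S (u + u') x = tmul S u x + tmul S u' x :=
  congrArg (Submodule.Quotient.mk (p := relations S U X)) (TensorProduct.add_tmul u u' x)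

theorem tmul_add (u : U) (x x' : X) : tmul S u (x + x') = tmul S u x + tmul S u x' :=
  congrArg (Submodule.Quotient.mk (p := relations S U X)) (TensorProduct.tmul_add u x x')

theorem smul_tmul (u : U) (s : S) (x : X) :
    tmul S (MulOpposite.op s • u) x = tmul S u (s • x) :=
  (Submodule.Quotient.eq (relations S U X)).2 (Submodule.subset_span ⟨u, s, x, rfl⟩)

/-- `x ↦ u ⊗ x`. -/
def mkHom (u : U) : X →+ BTensor S U X := AddMonoidHom.mk' (tmul S u) (tmul_add u)

@[simp] theorem mkHom_apply (u : U) (x : X) : mkHom u x = tmul S u x := rfl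

@[simp] theorem tmul_zero (u : U) : tmul S u (0 : X) = 0 := (mkHom u).map_zero

@[simp] theorem zero_tmul (x : X) : tmul S (0 : U) x = 0 :=
  (AddMonoidHom.mk' (fun u : U => tmul S u x) (fun u u' => add_tmul u u' x)).map_zero

theorem sum_tmul {ι : Type*} (s : Finset ι) (f : ι → U) (x : X) :
    tmul S (∑ i ∈ s, f i) x = ∑ i ∈ s, tmul S (f i) x :=
  map_sum (AddMonoidHom.mk' (fun u : U => tmul S u x) (fun u u' => add_tmul u u' x)) f s

/-- The additive map out of `U ⊗_S X` defined by a balanced biadditive map. -/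
def lift {Z : Type v} [AddCommGroup Z] (f : U →+ X →+ Z)
    (hf : ∀ u (s : S) x, f (MulOpposite.op s • u) x = f u (s • x)) : BTensor S U X →+ Z :=
  ((relations S U X).liftQ
    (TensorProduct.liftAddHom f (fun r u x => by simp)).toIntLinearMap (by
      refine Submodule.span_le.2 ?_
      rintro _ ⟨u, s, x, rfl⟩
      simp [hf])).toAddMonoidHom

@[simp] theorem lift_tmul {Z : Type v} [AddCommGroup Z] (f : U →+ X →+ Z)
    (hf : ∀ u (s : S) x, f (MulOpposite.op s • u) x = f u (s • x)) (u : U) (x : X) :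
    lift f hf (tmul S u x) = f u x := rfl

/-- Version of `lift` for a function of two variables. -/
def lift' {Z : Type v} [AddCommGroup Z] (f : U → X → Z)
    (h₁ : ∀ u u' x, f (u + u') x = f u x + f u' x) (h₂ : ∀ u x x', f u (x + x') = f u x + f u x')
    (hf : ∀ u (s : S) x, f (MulOpposite.op s • u) x = f u (s • x)) : BTensor S U X →+ Z :=
  lift (AddMonoidHom.mk' (fun u => AddMonoidHom.mk' (f u) (h₂ u))
    (fun u u' => AddMonoidHom.ext (h₁ u u'))) hf

@[simp] theorem lift'_tmul {Z : Type v} [AddCommGroup Z] (f : U → X → Z)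
    (h₁ : ∀ u u' x, f (u + u') x = f u x + f u' x) (h₂ : ∀ u x x', f u (x + x') = f u x + f u x')
    (hf : ∀ u (s : S) x, f (MulOpposite.op s • u) x = f u (s • x)) (u : U) (x : X) :
    lift' f h₁ h₂ hf (tmul S u x) = f u x := rfl

theorem hom_ext {Z : Type*} [AddCommGroup Z] {f g : BTensor S U X →+ Z}
    (h : ∀ u x, f (tmul S u x) = g (tmul S u x)) : f = g := by
  ext t
  induction t using induction_on with
  | h0 => simp
  | hmul u x => exact h u x
  | hadd a b ha hb => rw [map_add, map_add, ha, hb]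

section Module

variable {R : Type v} [Ring R] [Module R U] [SMulCommClass R Sᵐᵒᵖ U]

variable (S U X R) in
/-- The action of `R` on `U ⊗_S X`, as a representation. -/
def actionHom : R →+* AddMonoid.End (BTensor S U X) where
  toFun r := lift' (fun u x => tmul S (r • u) x)
    (fun u u' x => by rw [smul_add, add_tmul]) (fun u x x' => tmul_add _ x x')
    (fun u s x => by rw [smul_comm, smul_tmul])
  map_one' := hom_ext fun u x => congrArg (fun w => tmul S w x) (one_smul R u)
  map_mul' a b := hom_ext fun u x => congrArg (fun w => tmul S w x) (mul_smul a b u)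
  map_zero' := hom_ext fun u x =>
    (congrArg (fun w => tmul S w x) (zero_smul R u)).trans (zero_tmul x)
  map_add' a b := hom_ext fun u x =>
    (congrArg (fun w => tmul S w x) (add_smul a b u)).trans (add_tmul _ _ x)

instance : Module R (BTensor S U X) := Module.compHom _ (actionHom S U X R)

theorem smul_def (r : R) (u : U) (x : X) : r • tmul S u x = tmul S (r • u) x := rfl

theorem map_smul_of_tmul {Z : Type*} [AddCommGroup Z] [Module R Z] (f : BTensor S U X →+ Z)
    (h : ∀ (r : R) u x, f (tmul S (r • u) x) = r • f (tmul S u x)) (r : R) (t : BTensor S U X) :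
    f (r • t) = r • f t := by
  induction t using induction_on with
  | h0 => simp
  | hmul u x => rw [smul_def, h]
  | hadd a b ha hb => rw [smul_add, map_add, map_add, smul_add, ha, hb]

/-- An additive map that is linear on pure tensors, as a linear map. -/
def toLinear {Z : Type*} [AddCommGroup Z] [Module R Z] (f : BTensor S U X →+ Z)
    (h : ∀ (r : R) u x, f (tmul S (r • u) x) = r • f (tmul S u x)) : BTensor S U X →ₗ[R] Z :=
  { f with map_smul' := map_smul_of_tmul f h }

end Module

/-! #### Functoriality -/

variable {U' U'' X' X'' : Type v} [AddCommGroup U'] [Module Sᵐᵒᵖ U'] [AddCommGroup U'']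
  [Module Sᵐᵒᵖ U''] [AddCommGroup X'] [Module S X'] [AddCommGroup X''] [Module S X'']

/-- The map `f ⊗ g`. -/
def map (f : U →ₗ[Sᵐᵒᵖ] U') (g : X →ₗ[S] X') : BTensor S U X →+ BTensor S U' X' :=
  lift' (fun u x => tmul S (f u) (g x)) (fun u u' x => by rw [map_add, add_tmul])
    (fun u x x' => by rw [map_add, tmul_add]) (fun u s x => by rw [map_smul, smul_tmul, map_smul])

@[simp] theorem map_tmul (f : U →ₗ[Sᵐᵒᵖ] U') (g : X →ₗ[S] X') (u : U) (x : X) :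
    map f g (tmul S u x) = tmul S (f u) (g x) := rfl

theorem map_map (f : U →ₗ[Sᵐᵒᵖ] U') (g : X →ₗ[S] X') (f' : U' →ₗ[Sᵐᵒᵖ] U'') (g' : X' →ₗ[S] X'')
    (t : BTensor S U X) : map f' g' (map f g t) = map (f' ∘ₗ f) (g' ∘ₗ g) t :=
  DFunLike.congr_fun (hom_ext (f := (map f' g').comp (map f g)) fun u x => by simp) t

theorem map_id (t : BTensor S U X) : map (LinearMap.id : U →ₗ[Sᵐᵒᵖ] U) (LinearMap.id : X →ₗ[S] X) t
    = t :=
  DFunLike.congr_fun (hom_ext (g := AddMonoidHom.id _) fun u x => by simp) t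

theorem map_zero_right (f : U →ₗ[Sᵐᵒᵖ] U') (t : BTensor S U X) :
    map f (0 : X →ₗ[S] X') t = 0 :=
  DFunLike.congr_fun (hom_ext (g := 0) fun u x => by simp) t

theorem map_zero_left (g : X →ₗ[S] X') (t : BTensor S U X) :
    map (0 : U →ₗ[Sᵐᵒᵖ] U') g t = 0 :=
  DFunLike.congr_fun (hom_ext (g := 0) fun u x => by simp) t

theorem map_add_left (f f' : U →ₗ[Sᵐᵒᵖ] U') (g : X →ₗ[S] X') (t : BTensor S U X) :
    map (f + f') g t = map f g t + map f' g t :=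
  DFunLike.congr_fun (hom_ext (g := map f g + map f' g) fun u x => by simp [add_tmul]) t

theorem map_surjective (f : U →ₗ[Sᵐᵒᵖ] U') (g : X →ₗ[S] X') (hf : Function.Surjective f)
    (hg : Function.Surjective g) : Function.Surjective (map f g) := by
  intro t
  induction t using induction_on with
  | h0 => exact ⟨0, map_zero _⟩
  | hmul u x =>
    obtain ⟨u, rfl⟩ := hf u
    obtain ⟨x, rfl⟩ := hg x
    exact ⟨tmul S u x, rfl⟩
  | hadd a b ha hb =>
    obtain ⟨a, rfl⟩ := ha
    obtain ⟨b, rfl⟩ := hb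
    exact ⟨a + b, map_add _ _ _⟩

/-! #### Exactness -/

section Coordinates

/-- The map `U ⊗_S X → X^{(U)}` given by a map `U → S^{(U)}` of right modules. -/
def coord (s : U →ₗ[Sᵐᵒᵖ] (U →₀ Sᵐᵒᵖ)) (X : Type v) [AddCommGroup X] [Module S X] :
    BTensor S U X →+ (U →₀ X) :=
  lift' (fun u x => (s u).mapRange (fun c => c.unop • x) (by simp))
    (fun u u' x => by ext i; simp [add_smul]) (fun u x x' => by ext i; simp)
    (fun u c x => by ext i; simp [mul_smul])

theorem coord_tmul_apply (s : U →ₗ[Sᵐᵒᵖ] (U →₀ Sᵐᵒᵖ)) (u i : U) (x : X) :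
    coord s X (tmul S u x) i = (s u i).unop • x := rfl

/-- The map `X^{(U)} → U ⊗_S X`, `(x_u) ↦ ∑ u ⊗ x_u`. -/
def total (U X : Type v) [AddCommGroup U] [Module Sᵐᵒᵖ U] [AddCommGroup X] [Module S X] :
    (U →₀ X) →+ BTensor S U X :=
  Finsupp.liftAddHom fun u => mkHom u

theorem total_single (u : U) (x : X) : total U X (Finsupp.single u x) = tmul S u x := by
  simp [total]

/-- A section `s` writes `u` as a combination of elements `i` with coefficients `s u i`; moving
these across the tensor sign recovers `u ⊗ x`. Thus, for projective `U`, `U ⊗_S X` is a retract of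
`X^(U)`, naturally in `X`, and inherits its exactness. -/
theorem total_coord (s : U →ₗ[Sᵐᵒᵖ] (U →₀ Sᵐᵒᵖ))
    (hs : Finsupp.linearCombination Sᵐᵒᵖ id ∘ₗ s = LinearMap.id) (t : BTensor S U X) :
    total U X (coord s X t) = t := by
  refine DFunLike.congr_fun (hom_ext (f := (total U X).comp (coord s X))
    (g := AddMonoidHom.id _) fun u x => ?_) t
  have h : coord s X (tmul S u x) = (s u).mapRange (fun c => c.unop • x) (by simp) := rfl
  have h' := LinearMap.congr_fun hs u
  simp only [LinearMap.comp_apply, Finsupp.linearCombination_apply, LinearMap.id_apply, id] at h'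
  simp only [AddMonoidHom.comp_apply, AddMonoidHom.id_apply, h, total, Finsupp.liftAddHom_apply]
  rw [Finsupp.sum_mapRange_index (by simp)]
  conv_rhs => rw [← h', Finsupp.sum, sum_tmul]
  refine Finset.sum_congr rfl fun i _ => ?_
  change tmul S i ((s u i).unop • x) = _
  rw [← smul_tmul, MulOpposite.op_unop]

theorem coord_map (s : U →ₗ[Sᵐᵒᵖ] (U →₀ Sᵐᵒᵖ)) (g : X →ₗ[S] X') (t : BTensor S U X) (i : U) :
    coord s X' (map LinearMap.id g t) i = g (coord s X t i) := by
  induction t using induction_on with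
  | h0 => simp
  | hmul u x => simp [coord_tmul_apply]
  | hadd a b ha hb => simp [ha, hb]

theorem map_total (g : X →ₗ[S] X') (z : U →₀ X) :
    map LinearMap.id g (total U X z) = total U X' (z.mapRange g (map_zero g)) := by
  induction z using Finsupp.induction_linear with
  | zero => simp
  | add a b ha hb =>
    rw [map_add, map_add, ha, hb, ← map_add]
    congr 1
    ext; simp
  | single u x => simp [total_single]

variable (U) [Module.Projective Sᵐᵒᵖ U]

theorem map_injective (g : X →ₗ[S] X') (hg : Function.Injective g) :
    Function.Injective (map (LinearMap.id : U →ₗ[Sᵐᵒᵖ] U) g) := by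
  obtain ⟨s, hs⟩ := (Module.projective_def' (R := Sᵐᵒᵖ) (P := U)).1 inferInstance
  rw [injective_iff_map_eq_zero]
  intro t ht
  rw [← total_coord s hs t]
  have : coord s X t = 0 := by
    ext i
    apply hg
    rw [← coord_map, ht]
    simp
  rw [this, map_zero]

theorem map_exact (g : X →ₗ[S] X') (g' : X' →ₗ[S] X'') (h : Function.Exact g g') :
    Function.Exact (map (LinearMap.id : U →ₗ[Sᵐᵒᵖ] U) g) (map (LinearMap.id : U →ₗ[Sᵐᵒᵖ] U) g') := by
  obtain ⟨s, hs⟩ := (Module.projective_def' (R := Sᵐᵒᵖ) (P := U)).1 inferInstance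
  intro t
  constructor
  · intro ht
    have hz : ∀ i, ∃ z, g z = coord s X' t i := fun i => (h _).1 (by
      rw [← coord_map, ht]
      simp)
    choose z hz using hz
    classical
    -- The chosen `z i` need not vanish where the coordinate does, so the sum runs over the support
    -- only.
    let w : U →₀ X := ∑ i ∈ (coord s X' t).support, Finsupp.single i (z i)
    refine ⟨total U X w, ?_⟩
    rw [map_total]
    conv_rhs => rw [← total_coord s hs t]
    congr 1
    ext i
    simp only [w, Finsupp.mapRange_apply, Finsupp.finsetSum_apply, Finsupp.single_apply,
      Finset.sum_ite_eq', Finsupp.mem_support_iff]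
    split_ifs with hi
    · exact hz i
    · rw [map_zero, not_not.1 hi]
  · rintro ⟨t, rfl⟩
    rw [map_map, h.linearMap_comp_eq_zero, map_zero_right]

end Coordinates

/-- A short exact sequence with projective third term splits. -/
theorem _root_.ProjBounded.exists_splitting {R M N P : Type*} [Ring R] [AddCommGroup M] [Module R M]
    [AddCommGroup N] [Module R N] [AddCommGroup P] [Module R P] [Module.Projective R P]
    (f : M →ₗ[R] N) (g : N →ₗ[R] P) (hf : Function.Injective f) (h : Function.Exact f g)
    (hg : Function.Surjective g) :
    ∃ (ρ : N →ₗ[R] M) (s : P →ₗ[R] N),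
      ρ ∘ₗ f = LinearMap.id ∧ f ∘ₗ ρ + s ∘ₗ g = LinearMap.id := by
  obtain ⟨s, hs⟩ := Module.projective_lifting_property g LinearMap.id hg
  have hs' : ∀ u, g (s u) = u := LinearMap.congr_fun hs
  have hr : ∀ u, ∃ w, f w = u - s (g u) := fun u => (h _).1 (by rw [map_sub, hs', sub_self])
  choose r hr using hr
  let ρ : N →ₗ[R] M :=
    { toFun := r
      map_add' := fun a b => hf (by rw [map_add, hr, hr, hr, map_add, map_add]; abel)
      map_smul' := fun a b => hf (by
        rw [RingHom.id_apply, map_smul, hr, hr, map_smul, map_smul, smul_sub]) }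
  refine ⟨ρ, s, LinearMap.ext fun u => hf ?_, LinearMap.ext fun u => ?_⟩
  · change f (r (f u)) = f u
    rw [hr, h.apply_apply_eq_zero, map_zero, sub_zero]
  · change f (r u) + s (g u) = u
    rw [hr, sub_add_cancel]

/-- A short exact sequence `0 → U → U' → U'' → 0` of right modules with `U''` projective remains
exact after tensoring. -/
theorem map_exact_left [Module.Projective Sᵐᵒᵖ U''] (f : U →ₗ[Sᵐᵒᵖ] U') (g : U' →ₗ[Sᵐᵒᵖ] U'')
    (hf : Function.Injective f) (h : Function.Exact f g) (hg : Function.Surjective g) (X : Type v)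
    [AddCommGroup X] [Module S X] :
    Function.Injective (map f (LinearMap.id : X →ₗ[S] X)) ∧
      Function.Exact (map f (LinearMap.id : X →ₗ[S] X)) (map g (LinearMap.id : X →ₗ[S] X)) := by
  -- The splitting of right modules survives tensoring, so nothing is required of `X`.
  obtain ⟨ρ, s, hρ, hsum⟩ := exists_splitting f g hf h hg
  refine ⟨Function.LeftInverse.injective (g := map ρ LinearMap.id) fun t => ?_, fun t => ⟨fun ht =>
    ⟨map ρ LinearMap.id t, ?_⟩, ?_⟩⟩
  · rw [map_map, hρ, LinearMap.comp_id, map_id]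
  · have h1 := map_id t
    rw [← hsum, map_add_left] at h1
    have h2 := map_map g (LinearMap.id : X →ₗ[S] X) s (LinearMap.id : X →ₗ[S] X) t
    rw [ht, map_zero, LinearMap.comp_id] at h2
    rw [map_map, LinearMap.comp_id]
    rw [← h2, add_zero] at h1
    exact h1
  · rintro ⟨t, rfl⟩
    rw [map_map, h.linearMap_comp_eq_zero, LinearMap.comp_id, map_zero_left]

end BTensor

end BTensor

/-! ### Bounds on projective dimension in short exact sequences -/

open CategoryTheory in
/-- The projective dimension of the `R`-module `M` is at most `n`. -/
def PdLE (R : Type v) [Ring R] (M : Type v) [AddCommGroup M] [Module R M] (n : ℕ) : Prop :=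
  HasProjectiveDimensionLE (ModuleCat.of R M) n

namespace PdLE

open CategoryTheory

variable {R : Type v} [Ring R] {M N P : Type v} [AddCommGroup M] [Module R M] [AddCommGroup N]
  [Module R N] [AddCommGroup P] [Module R P] {n m : ℕ}

theorem mono (h : PdLE R M n) (hnm : n ≤ m) : PdLE R M m :=
  -- The bound `≤ n` is by definition the strict bound `< n + 1`.
  letI : HasProjectiveDimensionLT (ModuleCat.of R M) (n + 1) := h
  hasProjectiveDimensionLT_of_ge _ (n + 1) _ (by omega)

theorem of_projective [Module.Projective R M] : PdLE R M n :=
  mono (n := 0) (projective_iff_hasProjectiveDimensionLT_one.1 inferInstance) (Nat.zero_le n)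

theorem projective (h : PdLE R M 0) : Module.Projective R M :=
  (IsProjective.iff_projective M).2 (projective_iff_hasProjectiveDimensionLT_one.2 h)

theorem of_linearEquiv (h : PdLE R M n) (e : M ≃ₗ[R] N) : PdLE R N n :=
  letI : HasProjectiveDimensionLT (ModuleCat.of R M) (n + 1) := h
  hasProjectiveDimensionLT_of_iso e.toModuleIso (n + 1)

theorem of_retract (h : PdLE R M n) (i : N →ₗ[R] M) (r : M →ₗ[R] N) (hri : ∀ x, r (i x) = x) :
    PdLE R N n :=
  letI : HasProjectiveDimensionLT (ModuleCat.of R M) (n + 1) := h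
  Retract.hasProjectiveDimensionLT
    (⟨ModuleCat.ofHom i, ModuleCat.ofHom r, by ext x; exact hri x⟩ :
      Retract (ModuleCat.of R N) (ModuleCat.of R M)) (n + 1)

variable {f : M →ₗ[R] N} {g : N →ₗ[R] P}

theorem _root_.ProjBounded.shortExact (hf : Function.Injective f) (h : Function.Exact f g)
    (hg : Function.Surjective g) :
    (ModuleCat.shortComplexOfCompEqZero f g h.linearMap_comp_eq_zero).ShortExact :=
  ModuleCat.shortComplex_shortExact _ h hf hg

theorem middle (hf : Function.Injective f) (h : Function.Exact f g) (hg : Function.Surjective g)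
    (hM : PdLE R M n) (hP : PdLE R P n) : PdLE R N n :=
  (shortExact hf h hg).hasProjectiveDimensionLT_X₂ (n + 1) hM hP

theorem right (hf : Function.Injective f) (h : Function.Exact f g) (hg : Function.Surjective g)
    (hM : PdLE R M n) (hN : PdLE R N (n + 1)) : PdLE R P (n + 1) :=
  (shortExact hf h hg).hasProjectiveDimensionLT_X₃ (n + 1) hM hN

theorem left (hf : Function.Injective f) (h : Function.Exact f g) (hg : Function.Surjective g)
    (hN : PdLE R N n) (hP : PdLE R P (n + 1)) : PdLE R M n :=
  (shortExact hf h hg).hasProjectiveDimensionLT_X₁ (n + 1) hN hP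

theorem ker [Module.Projective R N] (hg : Function.Surjective g) (h : PdLE R P (n + 1)) :
    PdLE R (LinearMap.ker g) n :=
  left (f := (LinearMap.ker g).subtype) (Submodule.subtype_injective _)
    (LinearMap.exact_subtype_ker_map g) hg of_projective h

end PdLE

/-! ### Modules over the enveloping algebra -/

/-- The action of `R ⊗ₖ Rᵒᵖ` on `U` is the one given by the two actions of `R`. -/
class IsEnvBimodule (k : Type u) [Field k] (R : Type v) [Ring R] [Algebra k R] (U : Type v)
    [AddCommGroup U] [Module (R ⊗[k] Rᵐᵒᵖ) U] [Module R U] [Module Rᵐᵒᵖ U] : Prop where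
  tmul_smul : ∀ (r : R) (s : Rᵐᵒᵖ) (u : U), (r ⊗ₜ[k] s) • u = r • s • u

section Env

variable (k : Type u) [Field k] {R : Type v} [Ring R] [Algebra k R]

instance (M : AlgBimodule k R) : IsEnvBimodule k R M where
  tmul_smul r s u := TensorProduct.Algebra.smul_def r s u

variable (R) in
/-- The left action of `R` on a module over `R ⊗ₖ Rᵒᵖ`. -/
abbrev envLeft (U : Type v) [AddCommGroup U] [Module (R ⊗[k] Rᵐᵒᵖ) U] : Module R U :=
  Module.compHom U (Algebra.TensorProduct.includeLeft : R →ₐ[k] R ⊗[k] Rᵐᵒᵖ).toRingHom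

variable (R) in
/-- The right action of `R` on a module over `R ⊗ₖ Rᵒᵖ`. -/
abbrev envRight (U : Type v) [AddCommGroup U] [Module (R ⊗[k] Rᵐᵒᵖ) U] : Module Rᵐᵒᵖ U :=
  Module.compHom U (Algebra.TensorProduct.includeRight : Rᵐᵒᵖ →ₐ[k] R ⊗[k] Rᵐᵒᵖ).toRingHom

theorem envLeft_smul (U : Type v) [AddCommGroup U] [Module (R ⊗[k] Rᵐᵒᵖ) U] (r : R) (u : U) :
    letI := envLeft k R U
    r • u = (r ⊗ₜ[k] (1 : Rᵐᵒᵖ)) • u := rfl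

theorem envRight_smul (U : Type v) [AddCommGroup U] [Module (R ⊗[k] Rᵐᵒᵖ) U] (r : Rᵐᵒᵖ) (u : U) :
    letI := envRight k R U
    r • u = ((1 : R) ⊗ₜ[k] r) • u := rfl

theorem isEnvBimodule_env (U : Type v) [AddCommGroup U] [Module (R ⊗[k] Rᵐᵒᵖ) U] :
    letI := envLeft k R U
    letI := envRight k R U
    IsEnvBimodule k R U :=
  letI := envLeft k R U
  letI := envRight k R U
  ⟨fun r s u => by
    rw [envLeft_smul, envRight_smul, ← mul_smul, Algebra.TensorProduct.tmul_mul_tmul, mul_one,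
      one_mul]⟩

theorem smulCommClass_env (U : Type v) [AddCommGroup U] [Module (R ⊗[k] Rᵐᵒᵖ) U] :
    letI := envLeft k R U
    letI := envRight k R U
    SMulCommClass R Rᵐᵒᵖ U :=
  letI := envLeft k R U
  letI := envRight k R U
  ⟨fun r s u => by
    rw [envLeft_smul, envRight_smul, envRight_smul, envLeft_smul, ← mul_smul, ← mul_smul,
      Algebra.TensorProduct.tmul_mul_tmul, Algebra.TensorProduct.tmul_mul_tmul, mul_one,
      one_mul, mul_one, one_mul]⟩

/-- An additive map compatible with the action of pure tensors, as a linear map. -/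
def envLinear {U V : Type v} [AddCommGroup U] [Module (R ⊗[k] Rᵐᵒᵖ) U] [AddCommGroup V]
    [Module (R ⊗[k] Rᵐᵒᵖ) V] (f : U →+ V)
    (h : ∀ (r : R) (s : Rᵐᵒᵖ) u, f ((r ⊗ₜ[k] s) • u) = (r ⊗ₜ[k] s) • f u) :
    U →ₗ[R ⊗[k] Rᵐᵒᵖ] V :=
  { f with
    map_smul' := fun e u => by
      change f (e • u) = e • f u
      induction e with
      | zero =>
        exact (congrArg f (zero_smul (R ⊗[k] Rᵐᵒᵖ) u)).trans
          ((map_zero f).trans (zero_smul (R ⊗[k] Rᵐᵒᵖ) (f u)).symm)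
      | tmul r s => exact h r s u
      | add a b ha hb => rw [add_smul, map_add, ha, hb, add_smul] }

section Restrict

variable {U V : Type v} [AddCommGroup U] [Module (R ⊗[k] Rᵐᵒᵖ) U] [Module R U] [Module Rᵐᵒᵖ U]
  [IsEnvBimodule k R U] [AddCommGroup V] [Module (R ⊗[k] Rᵐᵒᵖ) V] [Module R V] [Module Rᵐᵒᵖ V]
  [IsEnvBimodule k R V]

theorem IsEnvBimodule.left_smul (r : R) (u : U) : r • u = (r ⊗ₜ[k] (1 : Rᵐᵒᵖ)) • u := by
  rw [IsEnvBimodule.tmul_smul, one_smul]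

theorem IsEnvBimodule.right_smul (r : Rᵐᵒᵖ) (u : U) : r • u = ((1 : R) ⊗ₜ[k] r) • u := by
  rw [IsEnvBimodule.tmul_smul, one_smul]

/-- Scalars of `k` pass across `⊗ₖ`. This makes `x ↦ f (u ⊗ x)` in `HomBimodule.curry` linear over
`k`. -/
theorem IsEnvBimodule.right_algebraMap_smul (c : k) (u : U) :
    MulOpposite.op (algebraMap k R c) • u = algebraMap k R c • u := by
  rw [left_smul k (algebraMap k R c), right_smul k (MulOpposite.op (algebraMap k R c))]
  congr 1
  rw [Algebra.algebraMap_eq_smul_one, MulOpposite.op_smul, MulOpposite.op_one,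
    TensorProduct.tmul_smul, TensorProduct.smul_tmul']

theorem IsEnvBimodule.map_left (f : U →ₗ[R ⊗[k] Rᵐᵒᵖ] V) (r : R) (u : U) :
    f (r • u) = r • f u := by
  rw [left_smul k r u, left_smul k r (f u), map_smul]

/-- A linear map over the enveloping algebra, as a linear map of right modules. -/
def rightLinear (f : U →ₗ[R ⊗[k] Rᵐᵒᵖ] V) : U →ₗ[Rᵐᵒᵖ] V where
  toFun := f
  map_add' := map_add f
  map_smul' r u := by
    rw [IsEnvBimodule.right_smul k, IsEnvBimodule.right_smul k, map_smul, RingHom.id_apply]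

@[simp] theorem rightLinear_apply (f : U →ₗ[R ⊗[k] Rᵐᵒᵖ] V) (u : U) :
    rightLinear k f u = f u := rfl

end Restrict

/-! ### The bimodule of `k`-linear maps -/

section HomBimodule

/-- `Hom_k(X, N)` as a module over `R ⊗ₖ Rᵒᵖ`: `((r ⊗ s) φ)(x) = r φ(s x)`. -/
def HomBimodule (k : Type u) [Field k] (R : Type v) [Ring R] [Algebra k R]
    (X N : Type v) [AddCommGroup X] [Module k X] [Module R X]
    [IsScalarTower k R X] [AddCommGroup N] [Module k N] [Module R N] [IsScalarTower k R N] :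
    Type v := X →ₗ[k] N

variable (R) (X N : Type v) [AddCommGroup X] [Module k X] [Module R X]
    [IsScalarTower k R X] [AddCommGroup N] [Module k N] [Module R N] [IsScalarTower k R N]

namespace HomBimodule

instance : AddCommGroup (HomBimodule k R X N) := inferInstanceAs (AddCommGroup (X →ₗ[k] N))

instance : FunLike (HomBimodule k R X N) X N := inferInstanceAs (FunLike (X →ₗ[k] N) X N)

instance : LinearMapClass (HomBimodule k R X N) k X N :=
  inferInstanceAs (LinearMapClass (X →ₗ[k] N) k X N)

/-- The action of `R` through `N`. -/
def leftRep : R →ₐ[k] Module.End k (X →ₗ[k] N) where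
  toFun r :=
    { toFun := fun φ => (Algebra.lsmul k k N r).comp φ
      map_add' := fun φ ψ => by ext; simp
      map_smul' := fun c φ => by ext; simp [smul_comm r c] }
  map_one' := by ext; simp
  map_mul' a b := by ext; simp
  map_zero' := by ext; simp
  map_add' a b := by ext; simp
  commutes' c := by ext; simp

/-- The action of `Rᵒᵖ` through `X`. -/
def rightRep : Rᵐᵒᵖ →ₐ[k] Module.End k (X →ₗ[k] N) where
  toFun r := LinearMap.lcomp k N (Algebra.lsmul k k X r.unop)
  map_one' := by ext; simp
  map_mul' a b := by ext; simp
  map_zero' := by ext; simp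
  map_add' a b := by ext; simp
  commutes' c := by ext; simp

/-- The action of `R ⊗ₖ Rᵒᵖ`. -/
def rep : R ⊗[k] Rᵐᵒᵖ →ₐ[k] Module.End k (X →ₗ[k] N) :=
  Algebra.TensorProduct.lift (leftRep k R X N) (rightRep k R X N) fun _ _ =>
    LinearMap.ext fun _ => LinearMap.ext fun _ => rfl

instance : Module (R ⊗[k] Rᵐᵒᵖ) (HomBimodule k R X N) :=
  Module.compHom (X →ₗ[k] N) (rep k R X N).toRingHom

variable {R X N}

@[ext] theorem ext {φ ψ : HomBimodule k R X N} (h : ∀ x, φ x = ψ x) : φ = ψ := LinearMap.ext h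

@[simp] theorem add_apply (φ ψ : HomBimodule k R X N) (x : X) : (φ + ψ) x = φ x + ψ x := rfl

@[simp] theorem tmul_smul_apply (r : R) (s : Rᵐᵒᵖ) (φ : HomBimodule k R X N) (x : X) :
    ((r ⊗ₜ[k] s) • φ) x = r • φ (s.unop • x) := by
  change (rep k R X N (r ⊗ₜ[k] s) φ) x = _
  exact DFunLike.congr_fun (DFunLike.congr_fun (Algebra.TensorProduct.lift_tmul
    (leftRep k R X N) (rightRep k R X N) _ r s) φ) x

/-- A `k`-linear map, as an element of `Hom_k(X, N)`. -/
def of (φ : X →ₗ[k] N) : HomBimodule k R X N := φ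

@[simp] theorem of_apply (φ : X →ₗ[k] N) (x : X) : of (R := R) k φ x = φ x := rfl

/-- Composition with a linear map `N → N'`. -/
def postcomp {N' : Type v} [AddCommGroup N'] [Module k N'] [Module R N'] [IsScalarTower k R N']
    (g : N →ₗ[R] N') : HomBimodule k R X N →ₗ[R ⊗[k] Rᵐᵒᵖ] HomBimodule k R X N' :=
  envLinear k
    (AddMonoidHom.mk' (fun φ => of k ((g.restrictScalars k).comp (φ : X →ₗ[k] N)))
      (fun φ ψ => by ext x; exact map_add g _ _))
    (fun r s φ => by
      ext x
      rw [tmul_smul_apply]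
      change g (((r ⊗ₜ[k] s) • φ) x) = r • g (φ _)
      rw [tmul_smul_apply, map_smul])

@[simp] theorem postcomp_apply {N' : Type v} [AddCommGroup N'] [Module k N'] [Module R N']
    [IsScalarTower k R N'] (g : N →ₗ[R] N') (φ : HomBimodule k R X N) (x : X) :
    postcomp k g φ x = g (φ x) := rfl

variable {U : Type v} [AddCommGroup U] [Module (R ⊗[k] Rᵐᵒᵖ) U] [Module R U] [Module Rᵐᵒᵖ U]
  [SMulCommClass R Rᵐᵒᵖ U] [IsEnvBimodule k R U]

/-- The adjunction between `- ⊗_R X` and `Hom_k(X, -)`, from left to right. -/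
def curry (f : BTensor R U X →ₗ[R] N) : U →ₗ[R ⊗[k] Rᵐᵒᵖ] HomBimodule k R X N :=
  envLinear k
    (AddMonoidHom.mk' (fun u => of k
      { toFun := fun x => f (BTensor.tmul R u x)
        map_add' := fun x y => by rw [BTensor.tmul_add, map_add]
        map_smul' := fun c x => by
          rw [RingHom.id_apply, ← algebraMap_smul R c x, ← BTensor.smul_tmul,
            IsEnvBimodule.right_algebraMap_smul k, ← BTensor.smul_def, map_smul,
            algebraMap_smul] })
      (fun u u' => by ext x; simp [BTensor.add_tmul]))
    (fun r s u => by
      ext x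
      rw [tmul_smul_apply, IsEnvBimodule.tmul_smul]
      change f (BTensor.tmul R (r • s • u) x) = r • f (BTensor.tmul R u (s.unop • x))
      rw [← BTensor.smul_def, map_smul, ← BTensor.smul_tmul, MulOpposite.op_unop])

/-- The adjunction between `- ⊗_R X` and `Hom_k(X, -)`, from right to left. -/
def uncurry (φ : U →ₗ[R ⊗[k] Rᵐᵒᵖ] HomBimodule k R X N) : BTensor R U X →ₗ[R] N :=
  BTensor.toLinear (BTensor.lift' (fun u x => φ u x) (fun u u' x => by rw [map_add, add_apply])
    (fun u x x' => map_add (φ u) x x')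
    (fun u s x => by
      rw [IsEnvBimodule.right_smul k, map_smul, tmul_smul_apply, one_smul, MulOpposite.unop_op]))
    (fun r u x => by
      rw [BTensor.lift'_tmul, BTensor.lift'_tmul, IsEnvBimodule.left_smul k, map_smul,
        tmul_smul_apply, MulOpposite.unop_one, one_smul])

end HomBimodule

end HomBimodule

end Env

/-! ### Projective bimodules and tensoring their resolutions -/

section EnvProjective

variable (k : Type u) [Field k] {R : Type v} [Ring R] [Algebra k R]

namespace HomBimodule

variable {X N N' : Type v} [AddCommGroup X] [Module k X] [Module R X] [IsScalarTower k R X]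
  [AddCommGroup N] [Module k N] [Module R N] [IsScalarTower k R N]
  [AddCommGroup N'] [Module k N'] [Module R N'] [IsScalarTower k R N']

/-- Over a field `X` is `k`-projective, so `k`-linear maps out of it lift. -/
theorem postcomp_surjective (g : N →ₗ[R] N') (hg : Function.Surjective g) :
    Function.Surjective (postcomp (X := X) k g) := by
  intro φ
  obtain ⟨ψ, hψ⟩ := Module.projective_lifting_property (g.restrictScalars k)
    (φ : X →ₗ[k] N') hg
  exact ⟨of k ψ, ext k fun x => LinearMap.congr_fun hψ x⟩

end HomBimodule

variable (R) in
/-- The action of `k` on an `R`-module. -/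
abbrev baseModule (X : Type v) [AddCommGroup X] [Module R X] : Module k X :=
  Module.compHom X (algebraMap k R)

variable (R) in
theorem isScalarTower_baseModule (X : Type v) [AddCommGroup X] [Module R X] :
    letI := baseModule k R X
    IsScalarTower k R X :=
  letI := baseModule k R X
  ⟨fun c r x => by
    rw [Algebra.smul_def, mul_smul]
    rfl⟩

section

variable (U : Type v) [AddCommGroup U] [Module (R ⊗[k] Rᵐᵒᵖ) U] [Module R U] [Module Rᵐᵒᵖ U]
  [IsEnvBimodule k R U]

/-- `- ⊗_R X` is left adjoint to `Hom_k(X, -)`, which preserves surjections. Lifting the curried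
identity through `g` and uncurrying gives a section of `g`. -/
theorem projective_bTensor [SMulCommClass R Rᵐᵒᵖ U] [Module.Projective (R ⊗[k] Rᵐᵒᵖ) U]
    (X : Type v) [AddCommGroup X] [Module R X] : Module.Projective R (BTensor R U X) := by
  refine Module.Projective.of_lifting_property'' fun g hg => ?_
  let := baseModule k R X
  let := baseModule k R (BTensor R U X)
  let := baseModule k R (BTensor R U X →₀ R)
  have := isScalarTower_baseModule k R X
  have := isScalarTower_baseModule k R (BTensor R U X)
  have := isScalarTower_baseModule k R (BTensor R U X →₀ R)
  obtain ⟨φ, hφ⟩ := Module.projective_lifting_property (HomBimodule.postcomp (X := X) k g)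
    (HomBimodule.curry k (LinearMap.id : BTensor R U X →ₗ[R] BTensor R U X))
    (HomBimodule.postcomp_surjective k g hg)
  refine ⟨HomBimodule.uncurry k φ, LinearMap.toAddMonoidHom_injective ?_⟩
  refine BTensor.hom_ext fun u x => ?_
  exact DFunLike.congr_fun (LinearMap.congr_fun hφ u) x

theorem comm_one_tmul_mul (r : Rᵐᵒᵖ) (e : R ⊗[k] Rᵐᵒᵖ) :
    Algebra.TensorProduct.comm k R Rᵐᵒᵖ ((1 ⊗ₜ[k] r) * e) =
      r • Algebra.TensorProduct.comm k R Rᵐᵒᵖ e := by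
  induction e with
  | zero => simp
  | tmul a b =>
    rw [Algebra.TensorProduct.tmul_mul_tmul, Algebra.TensorProduct.comm_tmul,
      Algebra.TensorProduct.comm_tmul, one_mul, TensorProduct.smul_tmul', smul_eq_mul]
  | add a b ha hb => rw [mul_add, map_add, ha, hb, map_add, smul_add]

/-- Swapping factors turns the right structure of `R ⊗ₖ Rᵒᵖ` into that of `Rᵒᵖ ⊗ₖ R`, a scalar
extension of a `k`-space and hence free; `U` is a retract of a sum of copies. -/
theorem projective_right [Module.Projective (R ⊗[k] Rᵐᵒᵖ) U] : Module.Projective Rᵐᵒᵖ U := by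
  obtain ⟨s, hs⟩ := (Module.projective_def' (R := R ⊗[k] Rᵐᵒᵖ) (P := U)).1 inferInstance
  let c := Algebra.TensorProduct.comm k R Rᵐᵒᵖ
  have hc : ∀ (r : Rᵐᵒᵖ) (e : Rᵐᵒᵖ ⊗[k] R), c.symm (r • e) = (1 ⊗ₜ[k] r) * c.symm e := by
    intro r e
    apply c.injective
    rw [comm_one_tmul_mul, c.apply_symm_apply, c.apply_symm_apply]
  let i : U →ₗ[Rᵐᵒᵖ] (U →₀ Rᵐᵒᵖ ⊗[k] R) :=
    { toFun := fun u => (s u).mapRange c (map_zero c)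
      map_add' := fun u w => by ext j; simp
      map_smul' := fun r u => by
        ext j
        rw [IsEnvBimodule.right_smul k r u, map_smul]
        exact comm_one_tmul_mul k r _ }
  let π : (U →₀ Rᵐᵒᵖ ⊗[k] R) →ₗ[Rᵐᵒᵖ] U := Finsupp.lsum ℕ fun j =>
    { toFun := fun e => c.symm e • j
      map_add' := fun a b => by rw [map_add, add_smul]
      map_smul' := fun r e => by
        rw [hc, mul_smul, RingHom.id_apply, IsEnvBimodule.right_smul k r] }
  refine Module.Projective.of_split i π (LinearMap.ext fun u => ?_)
  have h := LinearMap.congr_fun hs u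
  simp only [LinearMap.comp_apply, Finsupp.linearCombination_apply, LinearMap.id_apply, id] at h
  change ((s u).mapRange c (map_zero c)).sum (fun j e => c.symm e • j) = u
  rw [Finsupp.sum_mapRange_index (by simp)]
  simpa using h

end

section Sequence

variable {k}
variable {U V W : Type v} [AddCommGroup U] [Module (R ⊗[k] Rᵐᵒᵖ) U] [Module R U] [Module Rᵐᵒᵖ U]
  [IsEnvBimodule k R U] [AddCommGroup V] [Module (R ⊗[k] Rᵐᵒᵖ) V] [Module R V] [Module Rᵐᵒᵖ V]
  [IsEnvBimodule k R V] [AddCommGroup W] [Module (R ⊗[k] Rᵐᵒᵖ) W] [Module R W] [Module Rᵐᵒᵖ W]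
  [IsEnvBimodule k R W] {f : U →ₗ[R ⊗[k] Rᵐᵒᵖ] V} {g : V →ₗ[R ⊗[k] Rᵐᵒᵖ] W}

theorem projective_right_of_shortExact [Module.Projective Rᵐᵒᵖ W] [Module.Projective Rᵐᵒᵖ V]
    (hf : Function.Injective f) (h : Function.Exact f g) (hg : Function.Surjective g) :
    Module.Projective Rᵐᵒᵖ U := by
  obtain ⟨ρ, -, hρ, -⟩ := exists_splitting (rightLinear k f) (rightLinear k g) hf h hg
  exact Module.Projective.of_split _ ρ hρ

variable [SMulCommClass R Rᵐᵒᵖ U] [SMulCommClass R Rᵐᵒᵖ V] [SMulCommClass R Rᵐᵒᵖ W]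

/-- The map `U ⊗_R X → V ⊗_R X` induced by a map of bimodules. -/
def envMap (f : U →ₗ[R ⊗[k] Rᵐᵒᵖ] V) (X : Type v) [AddCommGroup X] [Module R X] :
    BTensor R U X →ₗ[R] BTensor R V X :=
  BTensor.toLinear (BTensor.map (rightLinear k f) LinearMap.id) fun r u x => by
    rw [BTensor.map_tmul, BTensor.map_tmul, rightLinear_apply, rightLinear_apply,
      IsEnvBimodule.map_left k, ← BTensor.smul_def]

theorem envMap_shortExact [Module.Projective Rᵐᵒᵖ W] (hf : Function.Injective f)
    (h : Function.Exact f g) (hg : Function.Surjective g) (X : Type v) [AddCommGroup X]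
    [Module R X] :
    Function.Injective (envMap f X) ∧ Function.Exact (envMap f X) (envMap g X) ∧
      Function.Surjective (envMap g X) :=
  have H := BTensor.map_exact_left (rightLinear k f) (rightLinear k g) hf h hg X
  ⟨H.1, H.2, BTensor.map_surjective (rightLinear k g) LinearMap.id hg Function.surjective_id⟩

end Sequence

variable (R) in
theorem exists_projective_cover (U : Type v) [AddCommGroup U] [Module R U] :
    ∃ (F : Type v) (_ : AddCommGroup F) (_ : Module R F) (_ : Module.Projective R F)
      (g : F →ₗ[R] U), Function.Surjective g :=
  ⟨U →₀ R, inferInstance, inferInstance, inferInstance,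
    Finsupp.linearCombination _ id, Finsupp.linearCombination_id_surjective _ _⟩

/-- Tensoring over `R` with an arbitrary module does not increase the projective dimension of an
`R ⊗ₖ Rᵒᵖ`-module that is projective on the right. -/
theorem PdLE.bTensor (X : Type v) [AddCommGroup X] [Module R X] (n : ℕ) :
    ∀ (U : Type v) [AddCommGroup U] [Module (R ⊗[k] Rᵐᵒᵖ) U] [Module R U] [Module Rᵐᵒᵖ U]
      [IsEnvBimodule k R U] [SMulCommClass R Rᵐᵒᵖ U] [Module.Projective Rᵐᵒᵖ U],
      PdLE (R ⊗[k] Rᵐᵒᵖ) U n → PdLE R (BTensor R U X) n := by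
  induction n with
  | zero =>
    intro U _ _ _ _ _ _ _ h
    have := h.projective
    have := projective_bTensor (R := R) k U X
    exact PdLE.of_projective
  | succ n ih =>
    intro U _ _ _ _ _ _ _ h
    -- The syzygy is again right projective, being a right summand of `F`. So the induction applies
    -- to it, and right projectivity of `U` keeps the sequence exact after tensoring.
    obtain ⟨F, _, _, _, g, hg⟩ := exists_projective_cover (R ⊗[k] Rᵐᵒᵖ) U
    let := envLeft k R F
    let := envRight k R F
    have := isEnvBimodule_env (R := R) k F
    have := smulCommClass_env (R := R) k F
    let := envLeft k R (LinearMap.ker g)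
    let := envRight k R (LinearMap.ker g)
    have := isEnvBimodule_env (R := R) k (LinearMap.ker g)
    have := smulCommClass_env (R := R) k (LinearMap.ker g)
    have := projective_right (R := R) k F
    have := projective_bTensor (R := R) k F X
    have hinj := Submodule.subtype_injective (LinearMap.ker g)
    have hex := LinearMap.exact_subtype_ker_map g
    have := projective_right_of_shortExact (R := R) hinj hex hg
    obtain ⟨h1, h2, h3⟩ := envMap_shortExact hinj hex hg X
    exact PdLE.right h1 h2 h3 (ih _ (h.ker hg)) PdLE.of_projective

end EnvProjective

/-! ### Induction along `B ⊆ A` -/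

section Induction

variable {k : Type u} [Field k] {A : Type v} [Ring A] [Algebra k A]

instance subalgebraRightModule (B : Subalgebra k A) : Module (↥B)ᵐᵒᵖ A :=
  Module.compHom A (AlgHom.op B.val).toRingHom

theorem subalgebra_right_smul (B : Subalgebra k A) (b : (↥B)ᵐᵒᵖ) (a : A) :
    b • a = a * (b.unop : A) := rfl

instance (B : Subalgebra k A) : SMulCommClass A (↥B)ᵐᵒᵖ A where
  smul_comm a b x := (mul_assoc a x (b.unop : A)).symm

/-- The induced module `A ⊗_B X`. -/
def Ind (B : Subalgebra k A) (X : Type v) [AddCommGroup X] [Module B X] : Type v :=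
  BTensor B A X

namespace Ind

variable (B : Subalgebra k A)

instance (X : Type v) [AddCommGroup X] [Module B X] : AddCommGroup (Ind B X) :=
  inferInstanceAs (AddCommGroup (BTensor B A X))

instance (X : Type v) [AddCommGroup X] [Module B X] : Module A (Ind B X) :=
  inferInstanceAs (Module A (BTensor B A X))

variable {X Y Z : Type v} [AddCommGroup X] [Module B X] [AddCommGroup Y] [Module B Y]
  [AddCommGroup Z] [Module B Z]

/-- The class of a pure tensor. -/
def tmul (a : A) (x : X) : Ind B X := BTensor.tmul (S := B) a x

theorem smul_tmul (a a' : A) (x : X) : a • tmul B a' x = tmul B (a * a') x := rfl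

theorem tmul_eq (a : A) (x : X) : tmul B a x = a • tmul B 1 x := by
  rw [smul_tmul, mul_one]

theorem tmul_coe (b : B) (x : X) : tmul B (b : A) x = tmul B 1 (b • x) := by
  refine Eq.trans ?_ (BTensor.smul_tmul (1 : A) b x)
  change BTensor.tmul (S := B) _ _ = BTensor.tmul (S := B) _ _
  rw [subalgebra_right_smul, one_mul]
  rfl

theorem induction_on {p : Ind B X → Prop} (t : Ind B X) (h0 : p 0)
    (hmul : ∀ a x, p (tmul B a x)) (hadd : ∀ a b, p a → p b → p (a + b)) : p t :=
  BTensor.induction_on t h0 hmul hadd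

theorem hom_ext {M : Type*} [AddCommGroup M] [Module A M] {f g : Ind B X →ₗ[A] M}
    (h : ∀ x, f (tmul B 1 x) = g (tmul B 1 x)) : f = g :=
  LinearMap.toAddMonoidHom_injective (BTensor.hom_ext fun a x => by
    change f (tmul B a x) = g (tmul B a x)
    rw [tmul_eq, map_smul, map_smul, h])

variable (X) in
/-- The map `x ↦ 1 ⊗ x`. -/
def unit : X →ₗ[B] Ind B X where
  toFun x := tmul B 1 x
  map_add' x y := BTensor.tmul_add (S := B) (1 : A) x y
  map_smul' b x := by
    rw [← tmul_coe, tmul_eq, RingHom.id_apply]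
    rfl

@[simp] theorem unit_apply (x : X) : unit B X x = tmul B 1 x := rfl

section Lift

variable {M : Type v} [AddCommGroup M] [Module A M]

/-- The `A`-linear map `A ⊗_B X → M` corresponding to a `B`-linear map `X → M`. -/
def lift (f : X →ₗ[B] M) : Ind B X →ₗ[A] M :=
  BTensor.toLinear (BTensor.lift' (fun (a : A) x => a • f x) (fun a a' x => add_smul _ _ _)
    (fun a x y => by rw [map_add, smul_add])
    (fun a b x => by
      rw [f.map_smul, subalgebra_right_smul, mul_smul, MulOpposite.unop_op]
      rfl))
    (fun r a x => by
      rw [BTensor.lift'_tmul, BTensor.lift'_tmul, smul_eq_mul, mul_smul])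

@[simp] theorem lift_tmul (f : X →ₗ[B] M) (a : A) (x : X) : lift B f (tmul B a x) = a • f x := rfl

variable (M) in
/-- The action map `A ⊗_B M → M`. -/
def counit : Ind B M →ₗ[A] M := lift B LinearMap.id

@[simp] theorem counit_tmul (a : A) (x : M) : counit B M (tmul B a x) = a • x := rfl

theorem counit_surjective : Function.Surjective (counit B M) := fun x =>
  ⟨tmul B 1 x, by rw [counit_tmul, one_smul]⟩

end Lift

/-- Functoriality of induction. -/
def map (f : X →ₗ[B] Y) : Ind B X →ₗ[A] Ind B Y :=
  BTensor.toLinear (BTensor.map (LinearMap.id : A →ₗ[(↥B)ᵐᵒᵖ] A) f) fun _ _ _ => rfl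

/-- Induction is left adjoint to restriction, and restriction preserves surjections. -/
instance projective [Module.Projective B X] : Module.Projective A (Ind B X) := by
  refine Module.Projective.of_lifting_property'' fun g hg => ?_
  obtain ⟨φ, hφ⟩ := Module.projective_lifting_property (g.restrictScalars B) (unit B X) hg
  refine ⟨lift B φ, hom_ext B fun x => ?_⟩
  rw [LinearMap.comp_apply, lift_tmul, one_smul]
  exact LinearMap.congr_fun hφ x

/-! ### Induction and restriction when `A/B` is right projective -/

section RightProjective

/-- The projection `A → A / B` of right `B`-modules. -/
def quotientRight : A →ₗ[(↥B)ᵐᵒᵖ] quotientBimodule B where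
  toFun := (Submodule.mkQ (Subalgebra.toSubmodule B) : A → _)
  map_add' := map_add (Submodule.mkQ (Subalgebra.toSubmodule B))
  map_smul' _ _ := rfl

theorem quotientRight_surjective : Function.Surjective (quotientRight B) :=
  Submodule.mkQ_surjective (Subalgebra.toSubmodule B)

theorem quotientRight_eq_zero (a : A) : quotientRight B a = 0 ↔ a ∈ B :=
  Submodule.Quotient.mk_eq_zero (Subalgebra.toSubmodule B)

/-- The inclusion `B → A` of right `B`-modules. -/
def inclusionRight : (↥B)ᵐᵒᵖ →ₗ[(↥B)ᵐᵒᵖ] A where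
  toFun b := (b.unop : A)
  map_add' _ _ := rfl
  map_smul' _ _ := rfl

theorem inclusionRight_injective : Function.Injective (inclusionRight B) := fun _ _ h =>
  MulOpposite.unop_injective (Subtype.ext h)

theorem exact_inclusionRight : Function.Exact (inclusionRight B) (quotientRight B) := fun a => by
  rw [quotientRight_eq_zero]
  exact ⟨fun h => ⟨MulOpposite.op ⟨a, h⟩, rfl⟩, by rintro ⟨b, rfl⟩; exact b.unop.2⟩

/-- The projection `A ⊗_B X → (A / B) ⊗_B X`. -/
def proj (X : Type v) [AddCommGroup X] [Module B X] :
    Ind B X →ₗ[B] BTensor B (quotientBimodule B) X where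
  toFun := BTensor.map (quotientRight B) (LinearMap.id : X →ₗ[B] X)
  map_add' := map_add (BTensor.map (quotientRight B) (LinearMap.id : X →ₗ[B] X))
  map_smul' := BTensor.map_smul_of_tmul (R := B)
    (BTensor.map (quotientRight B) (LinearMap.id : X →ₗ[B] X)) fun _ _ _ => rfl

theorem proj_surjective : Function.Surjective (proj B X) :=
  BTensor.map_surjective _ _ (quotientRight_surjective B) Function.surjective_id

variable [Module.Projective (↥B)ᵐᵒᵖ (quotientBimodule B)]

theorem projective_right : Module.Projective (↥B)ᵐᵒᵖ A := by
  obtain ⟨ρ, s, -, hs⟩ := exists_splitting _ _ (inclusionRight_injective B)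
    (exact_inclusionRight B) (quotientRight_surjective B)
  refine Module.Projective.of_split (ρ.prod (quotientRight B)) ((inclusionRight B).coprod s) ?_
  rw [LinearMap.coprod_comp_prod, hs]

variable (X) in
theorem unit_injective_exact :
    Function.Injective (unit B X) ∧ Function.Exact (unit B X) (proj B X) := by
  obtain ⟨ρ, s, hρ, hs⟩ := exists_splitting _ _ (inclusionRight_injective B)
    (exact_inclusionRight B) (quotientRight_surjective B)
  -- This retraction is only additive, because `ρ` is linear only on the right; that is enough for
  -- injectivity and exactness.
  let r : BTensor B A X →+ X := BTensor.lift' (fun a x => (ρ a).unop • x)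
    (fun a a' x => by rw [map_add, MulOpposite.unop_add, add_smul]) (fun a x y => smul_add _ _ _)
    (fun a b x => by rw [map_smul, smul_eq_mul, MulOpposite.unop_mul, mul_smul]; rfl)
  have hr : ∀ x, r (unit B X x) = x := fun x => by
    change (ρ 1).unop • x = x
    have : ρ 1 = 1 := LinearMap.congr_fun hρ 1
    rw [this, MulOpposite.unop_one, one_smul]
  refine ⟨Function.LeftInverse.injective hr, fun t => ⟨fun ht => ⟨r t, ?_⟩, ?_⟩⟩
  -- The decomposition `a = ρ a + s (a mod B)` is tensored with `x`, and `ρ a`, lying in `B`, is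
  -- moved across.
  · have key : ∀ t : BTensor B A X, t = BTensor.tmul (S := B) (1 : A) (r t) +
        BTensor.map s (LinearMap.id : X →ₗ[B] X)
          (BTensor.map (quotientRight B) (LinearMap.id : X →ₗ[B] X) t) := by
      refine DFunLike.congr_fun (BTensor.hom_ext (f := AddMonoidHom.id _)
        (g := (BTensor.mkHom (S := B) (1 : A)).comp r + (BTensor.map s LinearMap.id).comp
          (BTensor.map (quotientRight B) LinearMap.id)) fun a x => ?_)
      change BTensor.tmul (S := B) a x = BTensor.tmul (S := B) (1 : A) ((ρ a).unop • x) +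
        BTensor.tmul (S := B) (s (quotientRight B a)) x
      rw [← show BTensor.tmul (S := B) ((ρ a).unop : A) x =
          BTensor.tmul (S := B) (1 : A) ((ρ a).unop • x) from tmul_coe B (ρ a).unop x,
        ← BTensor.add_tmul]
      congr 1
      exact (LinearMap.congr_fun hs a).symm
    have h := key t
    have ht' : BTensor.map (quotientRight B) (LinearMap.id : X →ₗ[B] X) t = 0 := ht
    rw [ht', map_zero, add_zero] at h
    exact h.symm
  · rintro ⟨x, rfl⟩
    change BTensor.tmul (S := B) (quotientRight B 1) x = 0
    rw [(quotientRight_eq_zero B 1).2 B.one_mem, BTensor.zero_tmul]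

theorem map_shortExact {f : X →ₗ[B] Y} {g : Y →ₗ[B] Z} (hf : Function.Injective f)
    (h : Function.Exact f g) (hg : Function.Surjective g) :
    Function.Injective (map B f) ∧ Function.Exact (map B f) (map B g) ∧
      Function.Surjective (map B g) :=
  have := projective_right B
  ⟨BTensor.map_injective A f hf, BTensor.map_exact A f g h,
    BTensor.map_surjective _ _ Function.surjective_id hg⟩

/-- Induction does not increase the projective dimension. -/
theorem pdLE (n : ℕ) : ∀ (X : Type v) [AddCommGroup X] [Module B X],
    PdLE B X n → PdLE A (Ind B X) n := by
  induction n with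
  | zero =>
    intro X _ _ h
    have := h.projective
    exact PdLE.of_projective
  | succ n ih =>
    intro X _ _ h
    obtain ⟨F, _, _, _, g, hg⟩ := exists_projective_cover B X
    obtain ⟨h1, h2, h3⟩ := map_shortExact B (Submodule.subtype_injective (LinearMap.ker g))
      (LinearMap.exact_subtype_ker_map g) hg
    exact PdLE.right h1 h2 h3 (ih _ (h.ker hg)) PdLE.of_projective

variable {B} {d : ℕ} (hd : PdLE (↥B ⊗[k] (↥B)ᵐᵒᵖ) (quotientBimodule B) d)
include hd

theorem pdLE_quotient (X : Type v) [AddCommGroup X] [Module B X] :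
    PdLE B (BTensor B (quotientBimodule B) X) d :=
  PdLE.bTensor k X d (quotientBimodule B) hd

theorem pdLE_restrict_ind {n : ℕ} (hX : PdLE B X n) (hn : d ≤ n) : PdLE B (Ind B X) n :=
  PdLE.middle (unit_injective_exact B X).1 (unit_injective_exact B X).2 (proj_surjective B) hX
    ((pdLE_quotient hd X).mono hn)

/-- `X` is the kernel of `A ⊗_B X → (A/B) ⊗_B X`, whose target has dimension at most `d`. -/
theorem pdLE_of_restrict_ind {n : ℕ} (hX : PdLE B (Ind B X) n) (hn : d ≤ n) : PdLE B X n :=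
  PdLE.left (unit_injective_exact B X).1 (unit_injective_exact B X).2 (proj_surjective B) hX
    ((pdLE_quotient hd X).mono (by omega))

variable {M : Type v} [AddCommGroup M] [Module A M]

-- Over `B` the counit is split by `x ↦ 1 ⊗ x`, so its kernel is a complement of the image of the
-- unit and maps isomorphically to the cokernel `(A/B) ⊗_B M`. The bound does not depend on `M`.
variable (M) in
theorem pdLE_ker_counit : PdLE B (LinearMap.ker (counit B M)) d := by
  refine (pdLE_quotient hd M).of_linearEquiv (LinearEquiv.ofBijective
    (proj B M ∘ₗ (LinearMap.ker (counit B M)).subtype.restrictScalars B) ⟨?_, fun w => ?_⟩).symm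
  · rw [injective_iff_map_eq_zero]
    rintro ⟨t, ht⟩ h
    obtain ⟨x, rfl⟩ := ((unit_injective_exact B M).2 t).1 h
    have hx : x = 0 := by
      rw [LinearMap.mem_ker, unit_apply, counit_tmul, one_smul] at ht
      exact ht
    subst hx
    exact Subtype.ext (map_zero _)
  · obtain ⟨t, rfl⟩ := proj_surjective B w
    refine ⟨⟨t - unit B M (counit B M t), ?_⟩, ?_⟩
    · rw [LinearMap.mem_ker, map_sub, unit_apply, counit_tmul, one_smul, sub_self]
    · change proj B M (t - unit B M (counit B M t)) = proj B M t
      rw [map_sub, (unit_injective_exact B M).2.apply_apply_eq_zero, sub_zero]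

/-- For a projective cover `F → M` over `B`, the induced map `A ⊗_B F → M` is onto and splits over
`A`. So `M` is a retract of `A ⊗_B F`, an extension of `(A/B) ⊗_B F` by a projective. -/
theorem pdLE_restrict_of_projective [Module.Projective A M] : PdLE B M d := by
  obtain ⟨F, _, _, _, g, hg⟩ := exists_projective_cover B M
  have hs : Function.Surjective (lift B g) := fun m => by
    obtain ⟨x, rfl⟩ := hg m
    exact ⟨tmul B 1 x, by rw [lift_tmul, one_smul]⟩
  obtain ⟨i, hi⟩ := Module.projective_lifting_property (lift B g) LinearMap.id hs
  exact (pdLE_restrict_ind hd (X := F) PdLE.of_projective le_rfl).of_retract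
    (i.restrictScalars B) ((lift B g).restrictScalars B) (LinearMap.congr_fun hi)

end RightProjective

end Ind

end Induction

/-! ### Maps that vanish on `Ext` in high degrees -/

section ExtVanishing

open CategoryTheory Abelian

variable {R : Type v} [Ring R]

/-- The linear map `h` induces zero on `Ext` in degrees larger than `n`. -/
def ExtVanishesAbove {M N : Type v} [AddCommGroup M] [Module R M] [AddCommGroup N] [Module R N]
    (h : M →ₗ[R] N) (n : ℕ) : Prop :=
  ∀ (j : ℕ) (_ : n < j) (Y : ModuleCat.{v} R) (e : Ext (ModuleCat.of R N) Y j),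
    (Ext.mk₀ (ModuleCat.ofHom h)).comp e (zero_add j) = 0

variable {M N P M' N' P' : Type v} [AddCommGroup M] [Module R M] [AddCommGroup N] [Module R N]
  [AddCommGroup P] [Module R P] [AddCommGroup M'] [Module R M'] [AddCommGroup N'] [Module R N']
  [AddCommGroup P'] [Module R P']

theorem extVanishesAbove_zero (n : ℕ) : ExtVanishesAbove (0 : M →ₗ[R] N) n := fun j _ Y e => by
  rw [ModuleCat.ofHom_zero, Ext.mk₀_zero, Ext.zero_comp]

/-- The identity of `Ext` of `N` factors through the map induced by `h`. -/
theorem ExtVanishesAbove.pdLE {h : M →ₗ[R] N} {n : ℕ} (H : ExtVanishesAbove h n) (s : N →ₗ[R] M)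
    (hs : ∀ x, h (s x) = x) : PdLE R N n := by
  refine (hasProjectiveDimensionLT_iff _ _).2 fun j hj Y e => ?_
  have h1 := H j (by omega) Y e
  have h2 : ModuleCat.ofHom s ≫ ModuleCat.ofHom h = 𝟙 (ModuleCat.of R N) := by
    ext x
    exact hs x
  have h3 := Ext.mk₀_comp_mk₀_assoc (ModuleCat.ofHom s) (ModuleCat.ofHom h) e
  rw [h1, h2, Ext.comp_zero, Ext.mk₀_id_comp] at h3
  exact h3.symm

theorem ExtVanishesAbove.of_shortExact {f : M →ₗ[R] N} {g : N →ₗ[R] P} {f' : M' →ₗ[R] N'}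
    {g' : N' →ₗ[R] P'} (hf : Function.Injective f) (hfg : Function.Exact f g)
    (hg : Function.Surjective g) (hf' : Function.Injective f') (hfg' : Function.Exact f' g')
    (hg' : Function.Surjective g') (a : M →ₗ[R] M') (b : N →ₗ[R] N') (c : P →ₗ[R] P')
    (hab : b ∘ₗ f = f' ∘ₗ a) (hbc : c ∘ₗ g = g' ∘ₗ b) {n : ℕ} (ha : ExtVanishesAbove a n)
    (hN' : PdLE R N' n) : ExtVanishesAbove c (n + 1) := by
  rintro (_ | i) hj Y e
  · omega
  have S := shortExact hf hfg hg
  have S' := shortExact hf' hfg' hg'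
  have : HasProjectiveDimensionLT (ModuleCat.of R N') (n + 1) := hN'
  -- Since `Ext` of `N'` vanishes in degree `i + 1`, the class `e` is the connecting image of some
  -- `β` in degree `i`. By naturality its pullback along `c` is the connecting image of the pullback
  -- of `β` along `a`, which is zero.
  obtain ⟨β, rfl⟩ := Ext.contravariant_sequence_exact₃ S' _ e
    (Ext.eq_zero_of_hasProjectiveDimensionLT _ (n + 1) (by omega)) (add_comm 1 i)
  let φ : ModuleCat.shortComplexOfCompEqZero f g hfg.linearMap_comp_eq_zero ⟶
      ModuleCat.shortComplexOfCompEqZero f' g' hfg'.linearMap_comp_eq_zero :=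
    { τ₁ := ModuleCat.ofHom a
      τ₂ := ModuleCat.ofHom b
      τ₃ := ModuleCat.ofHom c
      comm₁₂ := by
        ext x
        exact (LinearMap.congr_fun hab x).symm
      comm₂₃ := by
        ext x
        exact (LinearMap.congr_fun hbc x).symm }
  have nat := ShortComplex.ShortExact.extClass_naturality S S' φ
  have h1 : (Ext.mk₀ (ModuleCat.ofHom a)).comp β (zero_add i) = 0 := ha i (by omega) Y β
  have h2 := Ext.comp_assoc (Ext.mk₀ φ.τ₃) S'.extClass β (zero_add 1) (add_comm 1 i)
    (show 0 + 1 + i = i + 1 by omega)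
  refine h2.symm.trans ?_
  rw [← nat]
  refine (Ext.comp_assoc S.extClass (Ext.mk₀ φ.τ₁) β (add_zero 1) (zero_add i)
    (show 1 + 0 + i = i + 1 by omega)).trans ?_
  exact (congrArg (fun z => S.extClass.comp z (add_comm 1 i)) h1).trans (Ext.comp_zero _ _ _ _ _)

end ExtVanishing

/-! ### Relative resolutions and relative lifting -/

section Relative

variable {R S : Type v} [Ring R] [Ring S] (f : S →+* R)

/-- `C` has an exact resolution of length less than `n` by `(R, S)`-projective modules. -/
def HasRelLength : ℕ → ∀ (C : Type v) [AddCommGroup C] [Module R C], Prop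
  | 0, C, _, _ => Subsingleton C
  | n + 1, C, _, _ => ∃ (P : Type v) (_ : AddCommGroup P) (_ : Module R P) (g : P →ₗ[R] C),
      IsRelProjective f P ∧ Function.Surjective g ∧ HasRelLength n (LinearMap.ker g)

theorem hasRelLength_of_resolution (n : ℕ) : ∀ (C : Type v) [AddCommGroup C] [Module R C]
    (P : ℕ → ModuleCat.{v} R) (d : ∀ i, P (i + 1) →ₗ[R] P i) (ε : P 0 →ₗ[R] C)
    (_ : ∀ i, IsRelProjective f (P i)) (_ : ∀ i, n ≤ i → Subsingleton (P i))
    (_ : Function.Surjective ε) (_ : Function.Exact (d 0) ε)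
    (_ : ∀ i, Function.Exact (d (i + 1)) (d i)), HasRelLength f n C := by
  induction n with
  | zero =>
    intro C _ _ P d ε _ hs hε _ _
    have := hs 0 le_rfl
    exact hε.subsingleton
  | succ n ih =>
    intro C _ _ P d ε hP hs hε h0 hd
    refine ⟨P 0, inferInstance, inferInstance, ε, hP 0, hε,
      ih _ (fun i => P (i + 1)) (fun i => d (i + 1))
        ((d 0).codRestrict (LinearMap.ker ε) fun x => h0.apply_apply_eq_zero x)
        (fun i => hP _) (fun i hi => hs _ (by omega)) ?_ ?_ fun i => hd _⟩
    · rintro ⟨x, hx⟩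
      obtain ⟨y, rfl⟩ := (h0 x).1 hx
      exact ⟨y, rfl⟩
    · intro x
      rw [← hd 0 x]
      exact Subtype.ext_iff

variable {f}

/-- In the pullback `L` of `φ` and `g`, the `S`-section of `g` induces one of `L → P`. Relative
projectivity improves it to an `R`-section, whose second component is the lift. -/
theorem IsRelProjective.exists_lift {P N N' : Type v} [AddCommGroup P] [Module R P]
    [AddCommGroup N] [Module R N] [AddCommGroup N'] [Module R N'] (hP : IsRelProjective f P)
    (g : N →ₗ[R] N') (σ : N' →+ N) (hσ : IsLinearOver f σ) (hgσ : ∀ x, g (σ x) = x)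
    (φ : P →ₗ[R] N') : ∃ ψ : P →ₗ[R] N, ∀ x, g (ψ x) = φ x := by
  let L : Submodule R (P × N) :=
    LinearMap.ker (φ ∘ₗ LinearMap.fst R P N - g ∘ₗ LinearMap.snd R P N)
  have hL : ∀ x : L, φ x.1.1 = g x.1.2 := fun x => sub_eq_zero.1 x.2
  let s : P →+ L := AddMonoidHom.mk' (fun x => ⟨(x, σ (φ x)), sub_eq_zero.2 (hgσ _).symm⟩)
    fun x y => Subtype.ext (Prod.ext rfl (by simp))
  obtain ⟨τ, hτ⟩ := hP L (LinearMap.fst R P N ∘ₗ L.subtype) (fun x => ⟨s x, rfl⟩)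
    ⟨s, fun r x => Subtype.ext (Prod.ext rfl (by simp [s, hσ r])), fun x => rfl⟩
  refine ⟨LinearMap.snd R P N ∘ₗ L.subtype ∘ₗ τ, fun x => ?_⟩
  rw [LinearMap.comp_apply, LinearMap.comp_apply]
  exact (hL (τ x)).symm.trans (congrArg φ (hτ x))

end Relative

/-! ### Comparing a relative resolution with kernels of counits -/

section Comparison

variable {k : Type u} [Field k] {A : Type v} [Ring A] [Algebra k A] {B : Subalgebra k A}

namespace HomBimodule

variable {X N N' : Type v} [AddCommGroup X] [Module k X] [Module A X] [IsScalarTower k A X]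
  [AddCommGroup N] [Module k N] [Module A N] [IsScalarTower k A N]
  [AddCommGroup N'] [Module A N']

/-- A map `U → Hom_k(X, N)` that is killed by `g : N → N'` factors through `Hom_k(X, ker g)`. -/
def toKer {U : Type v} [AddCommGroup U] [Module (A ⊗[k] Aᵐᵒᵖ) U]
    (χ : U →ₗ[A ⊗[k] Aᵐᵒᵖ] HomBimodule k A X N) (g : N →ₗ[A] N') (h : ∀ u x, g (χ u x) = 0) :
    U →ₗ[A ⊗[k] Aᵐᵒᵖ] HomBimodule k A X (LinearMap.ker g) :=
  envLinear k
    (AddMonoidHom.mk' (fun u => of k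
      { toFun := fun x => ⟨χ u x, h u x⟩
        map_add' := fun x y => Subtype.ext (map_add (χ u) x y)
        map_smul' := fun c x => Subtype.ext (map_smul (χ u) c x) })
      fun u w => by
        ext x
        change χ (u + w) x = χ u x + χ w x
        rw [map_add, add_apply])
    fun r s u => by
      ext x
      rw [tmul_smul_apply]
      change χ ((r ⊗ₜ[k] s) • u) x = r • χ u (s.unop • x)
      rw [map_smul, tmul_smul_apply]

/-- Composition with `x ↦ 1 ⊗ x` commutes with the left action of `B`, since the unit is `B`-linear,
and with precomposition on `X`. -/
theorem exists_relative_section [Module k (Ind B N)] [IsScalarTower k A (Ind B N)] :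
    ∃ σ : HomBimodule k A X N →+ HomBimodule k A X (Ind B N),
      IsLinearOver (envInclusion B) σ ∧ ∀ φ, postcomp k (Ind.counit B N) (σ φ) = φ := by
  have hk : ∀ (c : k) (x : N), Ind.unit B N (c • x) = c • Ind.unit B N x := fun c x => by
    rw [← algebraMap_smul A c x, ← algebraMap_smul A c (Ind.unit B N x)]
    exact (Ind.unit B N).map_smul (algebraMap k B c) x
  let σ : HomBimodule k A X N →+ HomBimodule k A X (Ind B N) :=
    AddMonoidHom.mk' (fun φ => of k
      { toFun := fun x => Ind.unit B N (φ x)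
        map_add' := fun x y => by rw [map_add, map_add]
        map_smul' := fun c x => by rw [map_smul, hk, RingHom.id_apply] })
      fun φ ψ => by
        ext x
        exact map_add (Ind.unit B N) _ _
  have hσ : ∀ φ x, σ φ x = Ind.unit B N (φ x) := fun _ _ => rfl
  refine ⟨σ, fun s φ => ?_, fun φ => ?_⟩
  · induction s with
    | zero =>
      rw [map_zero]
      exact (congrArg σ (zero_smul (A ⊗[k] Aᵐᵒᵖ) φ)).trans
        ((map_zero σ).trans (zero_smul (A ⊗[k] Aᵐᵒᵖ) (σ φ)).symm)
    | tmul b c =>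
      have : envInclusion B (b ⊗ₜ[k] c) = (b : A) ⊗ₜ[k] MulOpposite.op (c.unop : A) := rfl
      ext x
      rw [this, hσ, tmul_smul_apply, tmul_smul_apply, hσ]
      exact (Ind.unit B N).map_smul b _
    | add s t hs ht => rw [map_add, add_smul, map_add, hs, ht, add_smul]
  · ext x
    rw [postcomp_apply, hσ, Ind.unit_apply, Ind.counit_tmul, one_smul]

end HomBimodule

variable [Module.Projective (↥B)ᵐᵒᵖ (quotientBimodule B)] {d : ℕ}
  (hd : PdLE (↥B ⊗[k] (↥B)ᵐᵒᵖ) (quotientBimodule B) d)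
include hd

/-- Projective `A`-modules have dimension at most `d` over `B`, and each syzygy step costs one more.
-/
theorem pdLE_restrict (n : ℕ) : ∀ (M : Type v) [AddCommGroup M] [Module A M],
    PdLE A M n → PdLE B M (n + d) := by
  induction n with
  | zero =>
    intro M _ _ h
    have := h.projective
    exact (Ind.pdLE_restrict_of_projective hd).mono (by omega)
  | succ n ih =>
    intro M _ _ h
    obtain ⟨F, _, _, _, g, hg⟩ := exists_projective_cover A M
    have hF : PdLE B F (n + d + 1) := (Ind.pdLE_restrict_of_projective hd).mono (by omega)
    have := PdLE.right (f := (LinearMap.ker g).subtype.restrictScalars B)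
      (g := g.restrictScalars B) (Submodule.subtype_injective _)
      (LinearMap.exact_subtype_ker_map g) hg (ih _ (h.ker hg)) hF
    exact this.mono (by omega)

/-- Induction on the relative length of `C`. A step replaces `Z`, `C` and `X` by the kernels of `Q →
Z`, `P → C` and `A ⊗_B X → X`. The given map `Z ⊗_A M → X` becomes the right end of a map of short
exact sequences whose left end the induction controls. -/
theorem extVanishesAbove_uncurry {M : Type v} [AddCommGroup M] [Module k M] [Module A M]
    [IsScalarTower k A M] {c : ℕ} (hc : d ≤ c) (n : ℕ) :
    ∀ (C : Type v) [AddCommGroup C] [Module (A ⊗[k] Aᵐᵒᵖ) C] (_ : HasRelLength (envInclusion B) n C)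
      (Z : Type v) [AddCommGroup Z] [Module (A ⊗[k] Aᵐᵒᵖ) Z] [Module A Z] [Module Aᵐᵒᵖ Z]
      [IsEnvBimodule k A Z] [SMulCommClass A Aᵐᵒᵖ Z] [Module.Projective Aᵐᵒᵖ Z]
      (ψ : Z →ₗ[A ⊗[k] Aᵐᵒᵖ] C) (X : Type v) [AddCommGroup X] [Module k X] [Module A X]
      [IsScalarTower k A X] (φ : C →ₗ[A ⊗[k] Aᵐᵒᵖ] HomBimodule k A M X),
      PdLE B X c → ExtVanishesAbove (HomBimodule.uncurry k (φ ∘ₗ ψ)) (c + n) := by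
  induction n with
  | zero =>
    intro C _ _ hC Z _ _ _ _ _ _ _ ψ X _ _ _ _ φ _
    have : Subsingleton C := hC
    have h0 : HomBimodule.uncurry k (φ ∘ₗ ψ) = 0 :=
      LinearMap.toAddMonoidHom_injective (BTensor.hom_ext fun z x => by
        change φ (ψ z) x = 0
        rw [Subsingleton.elim (ψ z) 0, map_zero]
        rfl)
    rw [h0]
    exact extVanishesAbove_zero _
  | succ n ih =>
    intro C _ _ hC Z _ _ _ _ _ _ _ ψ X _ _ _ _ φ hX
    obtain ⟨P, _, _, g, hP, hg, hK⟩ := hC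
    obtain ⟨Q, _, _, _, q, hq⟩ := exists_projective_cover (A ⊗[k] Aᵐᵒᵖ) Z
    let := envLeft k A Q
    let := envRight k A Q
    have := isEnvBimodule_env (R := A) k Q
    have := smulCommClass_env (R := A) k Q
    let := envLeft k A (LinearMap.ker q)
    let := envRight k A (LinearMap.ker q)
    have := isEnvBimodule_env (R := A) k (LinearMap.ker q)
    have := smulCommClass_env (R := A) k (LinearMap.ker q)
    have := projective_right (R := A) k Q
    have hinj := Submodule.subtype_injective (LinearMap.ker q)
    have hex := LinearMap.exact_subtype_ker_map q
    have := projective_right_of_shortExact (R := A) hinj hex hq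
    obtain ⟨h1, h2, h3⟩ := envMap_shortExact hinj hex hq M
    let := baseModule k A (Ind B X)
    have := isScalarTower_baseModule k A (Ind B X)
    obtain ⟨θ, hθ⟩ := Module.projective_lifting_property g (ψ ∘ₗ q) hg
    have hθ' : ∀ x, g (θ x) = ψ (q x) := LinearMap.congr_fun hθ
    obtain ⟨σ, hσ, hσ'⟩ := HomBimodule.exists_relative_section (k := k) (B := B) (X := M) (N := X)
    -- `P` is only relatively projective, so this lift needs the `Bᵉ`-splitting `σ`; the lift `θ`
    -- needs only projectivity of `Q`.
    obtain ⟨l, hl⟩ := hP.exists_lift _ σ hσ hσ' (φ ∘ₗ g)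
    have hl' : ∀ p m, Ind.counit B X (l p m) = φ (g p) m := fun p m =>
      DFunLike.congr_fun (hl p) m
    let ψ' : LinearMap.ker q →ₗ[A ⊗[k] Aᵐᵒᵖ] LinearMap.ker g :=
      (θ ∘ₗ (LinearMap.ker q).subtype).codRestrict _ fun x => by
        rw [LinearMap.mem_ker]
        exact (hθ' _).trans ((congrArg ψ x.2).trans (map_zero ψ))
    let φ' : LinearMap.ker g →ₗ[A ⊗[k] Aᵐᵒᵖ] HomBimodule k A M (LinearMap.ker (Ind.counit B X)) :=
      HomBimodule.toKer (l ∘ₗ (LinearMap.ker g).subtype) (Ind.counit B X) fun p m => by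
        refine (hl' _ m).trans ?_
        rw [show g ((LinearMap.ker g).subtype p) = 0 from p.2, map_zero]
        rfl
    -- The new kernel has dimension at most `d ≤ c` over `B`, so `c` stays fixed throughout the
    -- induction.
    have key := ih (LinearMap.ker g) hK (LinearMap.ker q) ψ' (LinearMap.ker (Ind.counit B X)) φ'
      ((Ind.pdLE_ker_counit hd X).mono hc)
    refine ExtVanishesAbove.of_shortExact h1 h2 h3
      (Submodule.subtype_injective (LinearMap.ker (Ind.counit B X)))
      (LinearMap.exact_subtype_ker_map _) (Ind.counit_surjective B)
      (HomBimodule.uncurry k (φ' ∘ₗ ψ')) (HomBimodule.uncurry k (l ∘ₗ θ)) _ ?_ ?_ key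
      ((Ind.pdLE B c X hX).mono (Nat.le_add_right c n))
    · exact LinearMap.toAddMonoidHom_injective (BTensor.hom_ext fun z m => rfl)
    · refine LinearMap.toAddMonoidHom_injective (BTensor.hom_ext fun z m => ?_)
      change φ (ψ (q z)) m = Ind.counit B X (l (θ z) m)
      rw [hl', hθ']

end Comparison

/-! ### Finiteness of `findim` as a uniform bound -/

open CategoryTheory in
theorem projectiveDimension_lt_top_iff {R : Type v} [Ring R] (M : ModuleCat.{v} R) :
    projectiveDimension M < ⊤ ↔ ∃ n, PdLE R M n := by
  rw [lt_top_iff_ne_top, projectiveDimension_ne_top_iff]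
  rfl

theorem findim_lt_top_iff (R : Type v) [Ring R] :
    findim R < ⊤ ↔ ∃ c, ∀ (M : Type v) [AddCommGroup M] [Module R M] [Module.Finite R M] (n : ℕ),
      PdLE R M n → PdLE R M c := by
  constructor
  · intro h
    obtain ⟨c, hc⟩ : ∃ c : ℕ, findim R ≤ (c : ℕ∞) := by
      generalize findim R = x at h
      induction x with
      -- The supremum may be `⊥`, where any natural number is a bound.
      | bot => exact ⟨0, bot_le⟩
      | coe x =>
        induction x with
        | top => exact absurd h (lt_irrefl _)
        | coe x => exact ⟨x, le_rfl⟩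
    refine ⟨c, fun M _ _ _ n hn => (CategoryTheory.projectiveDimension_le_iff _ c).1 ?_⟩
    have hM : CategoryTheory.projectiveDimension (ModuleCat.of R M) < ⊤ :=
      (projectiveDimension_lt_top_iff _).2 ⟨n, hn⟩
    exact (le_iSup_of_le (ModuleCat.of R M) (le_iSup_of_le ‹Module.Finite R M›
      (le_iSup (fun _ : CategoryTheory.projectiveDimension (ModuleCat.of R M) < ⊤ =>
        CategoryTheory.projectiveDimension (ModuleCat.of R M)) hM))).trans hc
  · rintro ⟨c, hc⟩
    refine lt_of_le_of_lt (b := ((c : ℕ∞) : WithBot ℕ∞)) (iSup_le fun M => iSup₂_le fun hM h => ?_)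
      (WithBot.coe_lt_coe.2 (WithTop.coe_lt_top c))
    obtain ⟨n, hn⟩ := (projectiveDimension_lt_top_iff M).1 h
    exact (CategoryTheory.projectiveDimension_le_iff _ c).2 (hc M n hn)

/-! ### Passing bounds from `B` to `A` -/

section Bounds

variable {k : Type u} [Field k] {A : Type v} [Ring A] [Algebra k A] {B : Subalgebra k A}

theorem projective_regular_right : Module.Projective Aᵐᵒᵖ (AlgBimodule.regular k A) :=
  Module.Projective.of_equiv (R := Aᵐᵒᵖ) (S := Aᵐᵒᵖ) (σ := RingHom.id _) (σ' := RingHom.id _)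
    (M := Aᵐᵒᵖ) (N := A)
    { toFun := MulOpposite.unop
      invFun := MulOpposite.op
      map_add' := fun _ _ => rfl
      map_smul' := fun _ _ => rfl
      left_inv := fun _ => rfl
      right_inv := fun _ => rfl }

/-- The action map `A ⊗_A M → M`. -/
def actionMap (M : Type v) [AddCommGroup M] [Module A M] :
    BTensor A (AlgBimodule.regular k A) M →ₗ[A] M :=
  BTensor.toLinear (BTensor.lift' (U := AlgBimodule.regular k A) (fun (a : A) (x : M) => a • x)
    (fun (a a' : A) x => add_smul a a' x) (fun (a : A) x y => smul_add a x y)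
    (fun (a b : A) x => mul_smul a b x)) fun r a x => mul_smul (r : A) a x

theorem exists_hasRelLength
    (h : relProjectiveDimension (envInclusion B) (AlgBimodule.regular k A) < ⊤) :
    ∃ n, HasRelLength (envInclusion B) n (AlgBimodule.regular k A) := by
  obtain ⟨n, hn⟩ := iInf_lt_iff.1 h
  obtain ⟨⟨P, d, ε, hP, hs, hε, h0, hd, -, -⟩, -⟩ := iInf_lt_iff.1 hn
  -- `HasRelLength` counts the terms `P_0, …, P_n`, hence `n + 1`.
  exact ⟨n + 1, hasRelLength_of_resolution _ _ _ P d ε hP (fun i hi => hs i (by omega)) hε h0 hd⟩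

variable [Module.Projective (↥B)ᵐᵒᵖ (quotientBimodule B)] {d : ℕ}
  (hd : PdLE (↥B ⊗[k] (↥B)ᵐᵒᵖ) (quotientBimodule B) d)
include hd

/-- The projective dimension over `A` is bounded in terms of the one over `B`. -/
theorem pdLE_of_restrict {n : ℕ} (hn : HasRelLength (envInclusion B) n (AlgBimodule.regular k A))
    {c : ℕ} (hc : d ≤ c) {M : Type v} [AddCommGroup M] [Module A M] (hM : PdLE B M c) :
    PdLE A M (c + n) := by
  let := baseModule k A M
  have := isScalarTower_baseModule k A M
  have := projective_regular_right (k := k) (A := A)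
  -- With `Z = C = A` the uncurried map is the action `A ⊗_A M → M`, which has the section `x ↦ 1 ⊗
  -- x`.
  have key := extVanishesAbove_uncurry hd hc n _ hn (AlgBimodule.regular k A) LinearMap.id M
    (HomBimodule.curry k (actionMap (k := k) M)) hM
  let s : M →ₗ[A] BTensor A (AlgBimodule.regular k A) M :=
    { toFun := fun x => BTensor.tmul A (U := AlgBimodule.regular k A) (1 : A) x
      map_add' := fun x y => BTensor.tmul_add _ x y
      map_smul' := fun a x =>
        (BTensor.smul_tmul (U := AlgBimodule.regular k A) (1 : A) a x).symm.trans
          (congrArg (fun w => BTensor.tmul A (U := AlgBimodule.regular k A) w x)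
            ((one_mul a).trans (mul_one a).symm)) }
  exact key.pdLE s fun x => one_smul A x

end Bounds

/-- The elements `1 ⊗ x_i` generate, for generators `x_i` of `X`. -/
theorem finite_ind {k : Type u} [Field k] {A : Type v} [Ring A] [Algebra k A]
    (B : Subalgebra k A) (X : Type v) [AddCommGroup X] [Module B X] [Module.Finite B X] :
    Module.Finite A (Ind B X) := by
  obtain ⟨n, f, hf⟩ := Module.Finite.exists_fin' B X
  refine Module.Finite.of_surjective
    (Fintype.linearCombination A fun i => Ind.tmul B 1 (f (Pi.single i 1))) fun t => ?_
  induction t using Ind.induction_on with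
  | h0 => exact ⟨0, map_zero _⟩
  | hmul a x =>
    obtain ⟨c, rfl⟩ := hf x
    refine ⟨fun i => a * (c i : A), ?_⟩
    have h : f c = ∑ i, c i • f (Pi.single i 1) := by
      conv_lhs => rw [← LinearMap.sum_single_apply (fun _ => B) c, map_sum]
      refine Finset.sum_congr rfl fun i _ => ?_
      rw [← map_smul, ← Pi.single_smul, smul_eq_mul, mul_one]
    rw [Fintype.linearCombination_apply, Ind.tmul_eq, h]
    change _ = a • Ind.unit B X _
    rw [map_sum, Finset.smul_sum]
    refine Finset.sum_congr rfl fun i _ => ?_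
    rw [mul_smul, map_smul, Ind.unit_apply]
    rfl
  | hadd s t hs ht =>
    obtain ⟨x, rfl⟩ := hs
    obtain ⟨y, rfl⟩ := ht
    exact ⟨x + y, map_add _ _ _⟩

end ProjBounded

end

theorem mainTheorem8 {k : Type u} [Field k] [IsAlgClosed k] {A : Type v} [Ring A] [Algebra k A]
    [FiniteDimensional k A] (B : Subalgebra k A)
    (hB : ProjBounded.IsStronglyProjBounded B)
    (hright : Module.Projective (↥B)ᵐᵒᵖ (ProjBounded.quotientBimodule B)) :
    ProjBounded.findim ↥B < ⊤ ↔ ProjBounded.findim A < ⊤ := by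
  open ProjBounded in
  obtain ⟨d, hd⟩ := (projectiveDimension_lt_top_iff _).1 hB.finite_projectiveDimension
  obtain ⟨n, hn⟩ := exists_hasRelLength hB.finite_relProjectiveDimension
  rw [findim_lt_top_iff, findim_lt_top_iff]
  constructor
  · rintro ⟨b, hb⟩
    -- The maximum is taken because the comparison requires a bound over `B` that is at least `d`.
    refine ⟨max b d + n, fun M _ _ _ m hm => ?_⟩
    -- `M` is finite-dimensional over `k`, since `A` is, and therefore finite over `B`.
    have : Module.Finite B M := by
      let := baseModule k A M
      have := isScalarTower_baseModule k A M
      have : IsScalarTower k B M := ⟨fun c b x => by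
        change (c • (b : A)) • x = c • ((b : A) • x)
        rw [smul_assoc]⟩
      have : Module.Finite k M := Module.Finite.trans A M
      exact Module.Finite.of_restrictScalars_finite k B M
    exact pdLE_of_restrict hd hn (le_max_right b d)
      ((hb M _ (pdLE_restrict hd m M hm)).mono (le_max_left b d))
  · rintro ⟨a, ha⟩
    refine ⟨a + d, fun X _ _ _ m hm => ?_⟩
    have := finite_ind B X
    have h := ha (Ind B X) m (Ind.pdLE B m X hm)
    exact Ind.pdLE_of_restrict_ind hd (pdLE_restrict hd a _ h) (Nat.le_add_left d a)
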